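/- All spaces are real. Let $X$ be a Banach space with topological dual $X'$. A norm bounded set $A\subseteq X$ is a \emph{Dunford--Pettis set} if every weakly null sequence $(f_n)$ in $X'$ converges to zero uniformly on $A$, that is, $\lim_{n\to\infty}\sup_{x\in A}|f_n(x)|=0$. A norm bounded set $A\subseteq X'$ is an \emph{L-Dunford--Pettis set} if for every weakly null sequence $(x_n)$ in $X$ whose set of terms is a Dunford--Pettis set, $\lim_{n\to\infty}\sup_{f\in A}|f(x_n)|=0$. The space $X$ has (i) the \emph{Dunford--Pettis property} if every weakly compact operator from $X$ into a Banach space maps weakly null sequences to norm null sequences; (ii) the \emph{Grothendieck property} if weak$^*$ and weak convergence of sequences in $X'$ coincide; (iii) the \emph{L-Dunford--Pettis property} if every L-Dunford--Pettis set in $X'$ is relatively weakly compact, that is, relatively compact in the topology $\sigma(X',X'')$. \textbf{Theorem.} Let $E$ be a Banach lattice, that is, a Banach space that is a vector lattice such that $|x|\le|y|$ implies $\|x\|\le\|y\|$. If $E$ has the Dunford--Pettis property and the Grothendieck property, then $E$ has the L-Dunford--Pettis property. -/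

import Mathlib

open Filter Topology

universe u v

/-- A sequence of a normed space converges to zero in the weak topology. -/
def IsWeaklyNull {X : Type u} [NormedAddCommGroup X] [NormedSpace ℝ X] (x : ℕ → X) : Prop :=
  Tendsto (fun n => toWeakSpace ℝ X (x n)) atTop (𝓝 0)

/-- The closure of `A` in the weak topology is weakly compact. -/
def IsRelativelyWeaklyCompact {X : Type u} [NormedAddCommGroup X] [NormedSpace ℝ X]
    (A : Set X) : Prop :=
  IsCompact (closure (toWeakSpace ℝ X '' A))

/-- A bounded operator is weakly compact if it maps the closed unit ball onto a relatively
weakly compact set. -/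
def IsWeaklyCompactOperator {X : Type u} {Y : Type v} [NormedAddCommGroup X] [NormedSpace ℝ X]
    [NormedAddCommGroup Y] [NormedSpace ℝ Y] (T : X →L[ℝ] Y) : Prop :=
  IsRelativelyWeaklyCompact (T '' Metric.closedBall 0 1)

/-- A bounded operator is completely continuous if it maps weakly null sequences to norm null
sequences. -/
def IsCompletelyContinuous {X : Type u} {Y : Type v} [NormedAddCommGroup X] [NormedSpace ℝ X]
    [NormedAddCommGroup Y] [NormedSpace ℝ Y] (T : X →L[ℝ] Y) : Prop :=
  ∀ x : ℕ → X, IsWeaklyNull x → Tendsto (fun n => T (x n)) atTop (𝓝 0)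

/-- A norm bounded subset `A` of `X` is a Dunford-Pettis set if every weakly null sequence of
the dual of `X` converges to zero uniformly on `A`. -/
def IsDunfordPettisSet {X : Type u} [NormedAddCommGroup X] [NormedSpace ℝ X]
    (A : Set X) : Prop :=
  Bornology.IsBounded A ∧
    ∀ f : ℕ → StrongDual ℝ X, IsWeaklyNull f →
      TendstoUniformlyOn (fun (n : ℕ) (x : X) => f n x) 0 atTop A

/-- A norm bounded subset `A` of the dual of `X` is an L-Dunford-Pettis set if every weakly null
sequence of `X` that is a Dunford-Pettis set converges to zero uniformly on `A`. -/
def IsLDunfordPettisSet {X : Type u} [NormedAddCommGroup X] [NormedSpace ℝ X]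
    (A : Set (StrongDual ℝ X)) : Prop :=
  Bornology.IsBounded A ∧
    ∀ x : ℕ → X, IsWeaklyNull x → IsDunfordPettisSet (Set.range x) →
      TendstoUniformlyOn (fun (n : ℕ) (f : StrongDual ℝ X) => f (x n)) 0 atTop A

/-- The Dunford-Pettis property: every weakly compact operator from `X` into a Banach space is
completely continuous. -/
def HasDunfordPettisProperty (X : Type u) [NormedAddCommGroup X] [NormedSpace ℝ X] : Prop :=
  ∀ (Y : Type u) [NormedAddCommGroup Y] [NormedSpace ℝ Y] [CompleteSpace Y] (T : X →L[ℝ] Y),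
    IsWeaklyCompactOperator T → IsCompletelyContinuous T

/-- The Grothendieck property: weak-star and weak convergence of sequences in the dual of `X`
coincide. -/
def HasGrothendieckProperty (X : Type u) [NormedAddCommGroup X] [NormedSpace ℝ X] : Prop :=
  ∀ (f : ℕ → StrongDual ℝ X) (g : StrongDual ℝ X),
    Tendsto (fun n => StrongDual.toWeakDual (f n)) atTop (𝓝 (StrongDual.toWeakDual g)) ↔
      Tendsto (fun n => toWeakSpace ℝ (StrongDual ℝ X) (f n)) atTop
        (𝓝 (toWeakSpace ℝ (StrongDual ℝ X) g))

/-- The L-Dunford-Pettis property: every L-Dunford-Pettis set in the dual of `X` is relatively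
weakly compact. -/
def HasLDunfordPettisProperty (X : Type u) [NormedAddCommGroup X] [NormedSpace ℝ X] : Prop :=
  ∀ A : Set (StrongDual ℝ X), IsLDunfordPettisSet A → IsRelativelyWeaklyCompact A

/-! ### A midpoint criterion for relative weak compactness. -/

section WeakCompactness

variable {F : Type*} [NormedAddCommGroup F] [NormedSpace ℝ F]

/-! By the Dunford–Pettis property the terms of every weakly null sequence of `E` form a
Dunford–Pettis set. Hence all weakly null sequences converge to zero uniformly on an
L-Dunford–Pettis set, and also on its convex hull `B`. It remains to show that such a bounded `B` is
relatively weakly compact.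

The Grothendieck property makes bounded disjoint sequences weakly null
(`HasGrothendieckProperty.isWeaklyNull_of_disjoint`). A disjointification argument then yields `u ≥
0` such that, up to `ε`, the members of `B` see only the part of the unit ball below `u`
(`exists_forall_abs_apply_posPart_sub_le`). On `[0, u]` they are dominated, up to `δ`, by one
positive functional `g` (`exists_dominating_functional`). So `B` behaves like a uniformly integrable
subset of an `L¹` space.

For such a set weak compactness comes from convexity. The function `f ↦ √(f² + g²)(u)` is bounded on
`B`, and a small midpoint defect forces two members of `B` to be close in norm. A convex set
carrying such functions at every scale has its bidual weak-star closure inside the space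
(`isRelativelyWeaklyCompact_of_midpoint`). -/

theorem IsRelativelyWeaklyCompact.mono {A B : Set F} (hB : IsRelativelyWeaklyCompact B)
    (h : A ⊆ B) : IsRelativelyWeaklyCompact A :=
  hB.of_isClosed_subset isClosed_closure (closure_mono (Set.image_mono h))

/-- If a point of the bidual lies in the weak-star closure of a bounded convex set on which some
bounded function is uniformly convex up to `θ`, then it is `θ`-close to the space itself. -/
theorem exists_norm_sub_inclusion_le_of_midpoint {B : Set F} (hconv : Convex ℝ B)
    {φ : WeakDual ℝ (StrongDual ℝ F)}
    (hφ : φ ∈ closure (NormedSpace.inclusionInDoubleDualWeak ℝ F '' (toWeakSpace ℝ F '' B)))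
    {θ : ℝ} {Φ : F → ℝ} {M η : ℝ} (hη : 0 < η) (hM : ∀ c ∈ B, |Φ c| ≤ M)
    (hΦ : ∀ c ∈ B, ∀ d ∈ B, Φ c + Φ d - 2 * Φ ((1 / 2 : ℝ) • (c + d)) ≤ η → ‖c - d‖ ≤ θ) :
    ∃ c : F, ‖WeakDual.toStrongDual φ - NormedSpace.inclusionInDoubleDual ℝ F c‖ ≤ θ := by
  set J : F → WeakDual ℝ (StrongDual ℝ F) :=
    fun x => NormedSpace.inclusionInDoubleDualWeak ℝ F (toWeakSpace ℝ F x) with hJ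
  have himg : NormedSpace.inclusionInDoubleDualWeak ℝ F '' (toWeakSpace ℝ F '' B) = J '' B := by
    rw [Set.image_image]
  rw [himg] at hφ
  have hne : ∀ V ∈ 𝓝 φ, ∃ c ∈ B, J c ∈ V := by
    intro V hV
    obtain ⟨_, hv, c, hc, rfl⟩ := mem_closure_iff_nhds.1 hφ V hV
    exact ⟨c, hc, hv⟩
  -- The supremum `α` of `a V` over neighbourhoods is the lower limit of `Φ` at `φ` along `B`. Near
  -- `φ` no value of `Φ` is much below `α`, while values barely above `α` occur in every
  -- neighbourhood.
  let a : Set (WeakDual ℝ (StrongDual ℝ F)) → ℝ := fun V => sInf (Φ '' {c | c ∈ B ∧ J c ∈ V})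
  have hbdd : ∀ V : Set (WeakDual ℝ (StrongDual ℝ F)), BddBelow (Φ '' {c | c ∈ B ∧ J c ∈ V}) := by
    rintro V
    refine ⟨-M, ?_⟩
    rintro _ ⟨c, ⟨hc, -⟩, rfl⟩
    exact (abs_le.1 (hM c hc)).1
  have hale : ∀ V : Set (WeakDual ℝ (StrongDual ℝ F)), ∀ c ∈ B, J c ∈ V → a V ≤ Φ c := fun V c hc hv =>
    csInf_le (hbdd V) ⟨c, ⟨hc, hv⟩, rfl⟩
  have hbddA : BddAbove (a '' {V | V ∈ 𝓝 φ}) := by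
    refine ⟨M, ?_⟩
    rintro _ ⟨V, hV, rfl⟩
    obtain ⟨c, hc, hv⟩ := hne V hV
    exact (hale V c hc hv).trans (abs_le.1 (hM c hc)).2
  set α := sSup (a '' {V | V ∈ 𝓝 φ}) with hα
  obtain ⟨_, ⟨V₀, hV₀, rfl⟩, hαV⟩ := exists_lt_of_lt_csSup (s := a '' {V | V ∈ 𝓝 φ})
    ⟨_, Set.univ, univ_mem, rfl⟩ (show α - η / 4 < α by linarith)
  have : LocallyConvexSpace ℝ (WeakDual ℝ (StrongDual ℝ F)) :=
    (WeakDual.withSeminorms ℝ (StrongDual ℝ F)).toLocallyConvexSpace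
  -- Convexity of `W` keeps midpoints in `V₀`, where `Φ > α - η / 4`. Two points of `W` with `Φ < α
  -- + η / 4` thus have midpoint defect below `η`.
  obtain ⟨W, ⟨hW, hWc⟩, hWV⟩ :=
    ((LocallyConvexSpace.convex_basis (𝕜 := ℝ) φ).mem_iff).1 hV₀
  have key : ∀ V ∈ 𝓝 φ, ∃ c ∈ B, J c ∈ V ∩ W ∧ Φ c < α + η / 4 := by
    intro V hV
    have hVW : V ∩ W ∈ 𝓝 φ := inter_mem hV hW
    have h1 : a (V ∩ W) ≤ α := le_csSup hbddA ⟨_, hVW, rfl⟩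
    obtain ⟨c₁, hc₁, hv₁⟩ := hne _ hVW
    obtain ⟨_, ⟨c, ⟨hc, hv⟩, rfl⟩, hlt⟩ := exists_lt_of_csInf_lt
      (s := Φ '' {c | c ∈ B ∧ J c ∈ V ∩ W}) ⟨_, c₁, ⟨hc₁, hv₁⟩, rfl⟩
      (show a (V ∩ W) < α + η / 4 by linarith)
    exact ⟨c, hc, hv, hlt⟩
  obtain ⟨c₀, hc₀, ⟨-, hc₀W⟩, hΦ₀⟩ := key Set.univ univ_mem
  refine ⟨c₀, ?_⟩
  have hJadd : ∀ x y : F, J ((1 / 2 : ℝ) • (x + y)) = (1 / 2 : ℝ) • J x + (1 / 2 : ℝ) • J y := by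
    intro x y
    simp only [hJ, map_smul, map_add, smul_add]
  -- `φ` is a weak-star limit of points `θ`-close to the fixed `c₀`, and closed balls of the bidual
  -- are weak-star closed.
  have hmem : φ ∈ closure (WeakDual.toStrongDual ⁻¹'
      Metric.closedBall (NormedSpace.inclusionInDoubleDual ℝ F c₀) θ) := by
    rw [mem_closure_iff_nhds]
    intro V hV
    obtain ⟨c, hc, ⟨hcV, hcW⟩, hΦc⟩ := key V hV
    refine ⟨J c, hcV, ?_⟩
    have hmidB : (1 / 2 : ℝ) • (c₀ + c) ∈ B := by
      rw [smul_add]; exact hconv hc₀ hc (by norm_num) (by norm_num) (by norm_num)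
    have hmidW : J ((1 / 2 : ℝ) • (c₀ + c)) ∈ V₀ := by
      rw [hJadd]; exact hWV (hWc hc₀W hcW (by norm_num) (by norm_num) (by norm_num))
    have h2 := hale V₀ _ hmidB hmidW
    have h3 := hΦ c₀ hc₀ c hc (by linarith)
    have h4 : WeakDual.toStrongDual (J c) - NormedSpace.inclusionInDoubleDual ℝ F c₀
        = NormedSpace.inclusionInDoubleDual ℝ F (c - c₀) := by
      rw [map_sub]; rfl
    have h5 : ‖WeakDual.toStrongDual (J c) - NormedSpace.inclusionInDoubleDual ℝ F c₀‖ ≤ θ := by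
      rw [h4]
      exact (NormedSpace.double_dual_bound ℝ F _).trans (by rwa [norm_sub_rev])
    exact (dist_eq_norm (E := StrongDual ℝ (StrongDual ℝ F)) _ _).trans_le h5
  rw [(WeakDual.isClosed_closedBall _ _).closure_eq] at hmem
  exact (dist_eq_norm (E := StrongDual ℝ (StrongDual ℝ F)) _ _).symm.trans_le hmem

/-- A bounded convex set of a Banach space that carries, for each `θ > 0`, a bounded function that
is uniformly convex up to `θ`, is relatively weakly compact. -/
theorem isRelativelyWeaklyCompact_of_midpoint [CompleteSpace F] {B : Set F} (hconv : Convex ℝ B)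
    (hB : Bornology.IsBounded B)
    (h : ∀ θ : ℝ, 0 < θ → ∃ (Φ : F → ℝ) (M η : ℝ), 0 < η ∧ (∀ c ∈ B, |Φ c| ≤ M) ∧
      ∀ c ∈ B, ∀ d ∈ B, Φ c + Φ d - 2 * Φ ((1 / 2 : ℝ) • (c + d)) ≤ η → ‖c - d‖ ≤ θ) :
    IsRelativelyWeaklyCompact B := by
  refine NormedSpace.isCompact_closure_of_isBounded ℝ F _ ?_ ?_
  · rwa [Set.preimage_image_eq _ (toWeakSpace ℝ F).injective]
  · intro φ hφ
    have hcl : IsClosed (Set.range (NormedSpace.inclusionInDoubleDualLi ℝ (E := F))) :=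
      (Isometry.isClosedEmbedding (α := F) (γ := StrongDual ℝ (StrongDual ℝ F))
        (NormedSpace.inclusionInDoubleDualLi ℝ (E := F)).isometry).isClosed_range
    have : WeakDual.toStrongDual φ ∈
        closure (Set.range (NormedSpace.inclusionInDoubleDualLi ℝ (E := F))) := by
      refine (Metric.mem_closure_iff (α := StrongDual ℝ (StrongDual ℝ F))).2 fun ε hε => ?_
      obtain ⟨Φ, M, η, hη, hM, hΦ⟩ := h (ε / 2) (by positivity)
      obtain ⟨c, hc⟩ := exists_norm_sub_inclusion_le_of_midpoint hconv hφ hη hM hΦ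
      refine ⟨_, ⟨c, rfl⟩, ?_⟩
      exact (dist_eq_norm (E := StrongDual ℝ (StrongDual ℝ F)) _ _).trans_lt
        (lt_of_le_of_lt hc (by linarith))
    rw [hcl.closure_eq] at this
    obtain ⟨x, hx⟩ := this
    refine ⟨toWeakSpace ℝ F x, ?_⟩
    exact (WeakDual.toStrongDual).injective hx

end WeakCompactness

/-! ### Operators into `c₀` and the Dunford–Pettis property. -/

section DunfordPettis

open scoped ZeroAtInfty

theorem tendsto_toWeakSpace_iff {X ι : Type*} [NormedAddCommGroup X] [NormedSpace ℝ X]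
    {l : Filter ι} {x : ι → X} {a : X} :
    Tendsto (fun n => toWeakSpace ℝ X (x n)) l (𝓝 (toWeakSpace ℝ X a)) ↔
      ∀ φ : StrongDual ℝ X, Tendsto (fun n => φ (x n)) l (𝓝 (φ a)) := by
  rw [(NormedSpace.isEmbedding_inclusionInDoubleDualWeak ℝ X).tendsto_nhds_iff,
    tendsto_iff_forall_eval_tendsto_topDualPairing]
  rfl

theorem isWeaklyNull_iff {X : Type*} [NormedAddCommGroup X] [NormedSpace ℝ X] {x : ℕ → X} :
    IsWeaklyNull x ↔ ∀ φ : StrongDual ℝ X, Tendsto (fun n => φ (x n)) atTop (𝓝 0) := by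
  have h := tendsto_toWeakSpace_iff (l := atTop) (x := x) (a := 0)
  simpa only [IsWeaklyNull, map_zero] using h

theorem abs_zeroAtInfty_apply_le {I : Type*} [TopologicalSpace I] (a : C₀(I, ℝ)) (i : I) :
    |a i| ≤ ‖a‖ :=
  a.toBCF.norm_coe_le_norm i

theorem norm_zeroAtInfty_le {I : Type*} [TopologicalSpace I] {a : C₀(I, ℝ)} {r : ℝ}
    (hr : 0 ≤ r) (h : ∀ i, |a i| ≤ r) : ‖a‖ ≤ r :=
  (BoundedContinuousFunction.norm_le hr).2 h

theorem tendsto_single_cofinite {I : Type*} [DecidableEq I] (i : I) (r : ℝ) :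
    Tendsto (Pi.single i r : I → ℝ) cofinite (𝓝 0) := by
  refine tendsto_const_nhds.congr' ?_
  filter_upwards [(Set.finite_singleton i).compl_mem_cofinite] with j hj
  simp [show j ≠ i from hj]

variable {I : Type*} [TopologicalSpace I] [DiscreteTopology I]

/-- A family of reals that tends to zero along the cofinite filter, as an element of `c₀`. -/
def zeroAtInftyOfCofinite (a : I → ℝ) (ha : Tendsto a cofinite (𝓝 0)) : C₀(I, ℝ) where
  toFun := a
  continuous_toFun := continuous_of_discreteTopology
  zero_at_infty' := by rwa [cocompact_eq_cofinite]

theorem tendsto_zeroAtInfty_cofinite (a : C₀(I, ℝ)) : Tendsto a cofinite (𝓝 0) := by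
  rw [← cocompact_eq_cofinite]; exact a.zero_at_infty'

/-- The unit vectors of `c₀`. -/
def zeroAtInftySingle [DecidableEq I] (i : I) : C₀(I, ℝ) :=
  zeroAtInftyOfCofinite (Pi.single i 1) (tendsto_single_cofinite i 1)

theorem sum_smul_zeroAtInftySingle_apply [DecidableEq I] (s : Finset I) (b : I → ℝ) (j : I) :
    (∑ i ∈ s, b i • zeroAtInftySingle i : C₀(I, ℝ)) j = if j ∈ s then b j else 0 := by
  have h : ∀ t : Finset I, (∑ i ∈ t, b i • zeroAtInftySingle i : C₀(I, ℝ)) j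
      = ∑ i ∈ t, b i * (Pi.single i 1 : I → ℝ) j := by
    intro t
    induction t using Finset.induction_on with
    | empty => simp
    | insert i t hi ih =>
      rw [Finset.sum_insert hi, Finset.sum_insert hi, ZeroAtInftyContinuousMap.add_apply, ih]
      rfl
  rw [h]
  simp [Pi.single_apply]

theorem hasSum_zeroAtInfty [DecidableEq I] (a : C₀(I, ℝ)) :
    HasSum (fun i => a i • (zeroAtInftySingle i : C₀(I, ℝ))) a := by
  refine Metric.tendsto_nhds.2 fun ε hε => ?_
  have hfin : {i | ¬ |a i| < ε / 2}.Finite := by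
    have := (tendsto_zeroAtInfty_cofinite a).eventually (Metric.ball_mem_nhds 0 (half_pos hε))
    simpa [Real.dist_eq] using eventually_cofinite.1 this
  filter_upwards [eventually_ge_atTop hfin.toFinset] with s hs
  rw [dist_eq_norm]
  refine lt_of_le_of_lt (norm_zeroAtInfty_le (half_pos hε).le fun j => ?_) (half_lt_self hε)
  rw [ZeroAtInftyContinuousMap.sub_apply, sum_smul_zeroAtInftySingle_apply]
  by_cases hj : j ∈ s
  · simpa [hj] using (half_pos hε).le
  · have : |a j| < ε / 2 := by
      by_contra hcon
      exact hj (hs (hfin.mem_toFinset.2 hcon))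
    simpa [hj] using this.le

/-- Testing `y` on finite sign vectors, which have norm at most one, bounds all partial sums by
`‖y‖`. -/
theorem summable_abs_apply_zeroAtInftySingle [DecidableEq I] (y : StrongDual ℝ C₀(I, ℝ)) :
    Summable fun i => |y (zeroAtInftySingle i)| := by
  refine summable_of_sum_le (c := ‖y‖) (fun _ => abs_nonneg _) fun s => ?_
  have h1 : ∑ i ∈ s, |y (zeroAtInftySingle i)|
      = y (∑ i ∈ s, (SignType.sign (y (zeroAtInftySingle i)) : ℝ) • zeroAtInftySingle i) := by
    rw [map_sum]
    refine Finset.sum_congr rfl fun i _ => ?_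
    rw [map_smul, smul_eq_mul, sign_mul_self]
  rw [h1]
  refine (le_abs_self _).trans ((y.le_opNorm _).trans (mul_le_of_le_one_right (norm_nonneg _) ?_))
  refine norm_zeroAtInfty_le zero_le_one fun j => ?_
  rw [sum_smul_zeroAtInftySingle_apply]
  split_ifs
  · rcases lt_trichotomy (y (zeroAtInftySingle j)) 0 with h | h | h <;> simp [h]
  · simp

variable {X : Type*} [NormedAddCommGroup X] [NormedSpace ℝ X]

/-- The operator into `c₀` whose coordinates are the members of a weakly null family. -/
theorem exists_isWeaklyCompactOperator_zeroAtInfty {f : I → StrongDual ℝ X} {C : ℝ}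
    (hC : ∀ i, ‖f i‖ ≤ C)
    (hf : ∀ ξ : StrongDual ℝ (StrongDual ℝ X), Tendsto (fun i => ξ (f i)) cofinite (𝓝 0)) :
    ∃ T : X →L[ℝ] C₀(I, ℝ), (∀ x i, T x i = f i x) ∧ IsWeaklyCompactOperator T := by
  classical
  let S : StrongDual ℝ (StrongDual ℝ X) →L[ℝ] C₀(I, ℝ) := LinearMap.mkContinuous
    { toFun := fun ξ => zeroAtInftyOfCofinite (fun i => ξ (f i)) (hf ξ)
      map_add' := fun _ _ => rfl
      map_smul' := fun _ _ => rfl } (max C 0) (by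
      intro ξ
      refine norm_zeroAtInfty_le (by positivity) fun i => ?_
      have := ξ.le_opNorm (f i)
      calc |ξ (f i)| ≤ ‖ξ‖ * ‖f i‖ := this
        _ ≤ ‖ξ‖ * max C 0 := by gcongr; exact (hC i).trans (le_max_left _ _)
        _ = _ := mul_comm _ _)
  have hS : ∀ ξ i, S ξ i = ξ (f i) := fun _ _ => rfl
  let T : X →L[ℝ] C₀(I, ℝ) := S.comp (NormedSpace.inclusionInDoubleDual ℝ X)
  have hT : ∀ x i, T x i = f i x := fun _ _ => rfl
  -- This makes `S` continuous from the weak-star to the weak topology: `y ∘ S` is evaluation at an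
  -- element of the dual of `X`, namely the norm convergent series of the `f i` with the
  -- coefficients of `y`.
  have hST : ∀ (y : StrongDual ℝ C₀(I, ℝ)) (ξ : StrongDual ℝ (StrongDual ℝ X)),
      y (S ξ) = ξ (y.comp T) := by
    intro y ξ
    have hsum : Summable fun i => y (zeroAtInftySingle i) • f i := by
      refine Summable.of_norm_bounded
        ((summable_abs_apply_zeroAtInftySingle y).mul_right C) fun i => ?_
      rw [norm_smul, Real.norm_eq_abs]
      gcongr
      exact hC i
    have hval : ∀ a : C₀(I, ℝ), HasSum (fun i => a i * y (zeroAtInftySingle i)) (y a) := by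
      intro a
      simpa [Function.comp_def] using y.hasSum (hasSum_zeroAtInfty a)
    have hcomp : y.comp T = ∑' i, y (zeroAtInftySingle i) • f i := by
      ext x
      have h1 := (ContinuousLinearMap.apply ℝ ℝ x).hasSum hsum.hasSum
      refine (hval (T x)).unique ?_
      exact h1.congr_fun fun i => mul_comm _ _
    rw [hcomp]
    refine (hval (S ξ)).unique ((ξ.hasSum hsum.hasSum).congr_fun fun i => ?_)
    rw [hS, map_smul, smul_eq_mul, mul_comm]
  refine ⟨T, hT, NormedSpace.isCompact_closure_of_isBounded ℝ _ _ ?_ ?_⟩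
  · rw [Set.preimage_image_eq _ (toWeakSpace ℝ _).injective]
    exact T.lipschitz.isBounded_image Metric.isBounded_closedBall
  · let R : WeakDual ℝ (StrongDual ℝ X) → WeakSpace ℝ C₀(I, ℝ) :=
      fun ξ => toWeakSpace ℝ _ (S (WeakDual.toStrongDual ξ))
    have hR : Continuous fun ξ => NormedSpace.inclusionInDoubleDualWeak ℝ _ (R ξ) := by
      refine WeakDual.continuous_of_continuous_eval fun y => ?_
      refine (WeakDual.eval_continuous (y.comp T)).congr fun ξ => ?_
      exact (hST y (WeakDual.toStrongDual ξ)).symm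
    -- By Banach–Alaoglu the image of the bidual ball under `S` is weakly compact, and it contains
    -- the image of the unit ball under `T`.
    have hK := ((WeakDual.isCompact_closedBall
      (0 : StrongDual ℝ (StrongDual ℝ X)) 1).image hR).isClosed
    refine (closure_minimal ?_ hK).trans ?_
    · rintro _ ⟨_, ⟨_, ⟨x, hx, rfl⟩, rfl⟩, rfl⟩
      refine ⟨StrongDual.toWeakDual (NormedSpace.inclusionInDoubleDual ℝ X x), ?_, rfl⟩
      rw [mem_closedBall_zero_iff] at hx
      rw [Set.mem_preimage, mem_closedBall_zero_iff]
      exact (NormedSpace.double_dual_bound ℝ X x).trans hx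
    · rintro _ ⟨ξ, -, rfl⟩
      exact ⟨_, rfl⟩

theorem IsWeaklyNull.exists_norm_le {x : ℕ → X} (hx : IsWeaklyNull x) : ∃ C, ∀ n, ‖x n‖ ≤ C := by
  rw [isWeaklyNull_iff] at hx
  obtain ⟨C, hC⟩ := banach_steinhaus (g := fun n => NormedSpace.inclusionInDoubleDual ℝ X (x n))
    fun φ => by
      obtain ⟨C, hC⟩ := (Metric.isBounded_range_of_tendsto _ (hx φ)).exists_norm_le
      exact ⟨C, fun n => hC _ ⟨n, rfl⟩⟩
  exact ⟨C, fun n => ((NormedSpace.inclusionInDoubleDualLi ℝ (E := X)).norm_map (x n)).symm.trans_le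
    (hC n)⟩

/-- In a space with the Dunford-Pettis property the terms of a weakly null sequence form a
Dunford-Pettis set. -/
theorem HasDunfordPettisProperty.isDunfordPettisSet_range {X : Type u} [NormedAddCommGroup X]
    [NormedSpace ℝ X] (hX : HasDunfordPettisProperty X) {x : ℕ → X} (hx : IsWeaklyNull x) :
    IsDunfordPettisSet (Set.range x) := by
  obtain ⟨C, hC⟩ := hx.exists_norm_le
  refine ⟨isBounded_iff_forall_norm_le.2 ⟨C, Set.forall_mem_range.2 hC⟩, fun f hf => ?_⟩
  obtain ⟨C', hC'⟩ := hf.exists_norm_le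
  -- The lifted index set places `c₀` in the universe over which `HasDunfordPettisProperty`
  -- quantifies.
  have hf' : ∀ ξ : StrongDual ℝ (StrongDual ℝ X),
      Tendsto (fun i : ULift.{u} ℕ => ξ (f i.down)) cofinite (𝓝 0) := fun ξ => by
    have h := isWeaklyNull_iff.1 hf ξ
    rw [← Nat.cofinite_eq_atTop] at h
    exact h.comp ULift.down_injective.tendsto_cofinite
  obtain ⟨T, hT, hTc⟩ := exists_isWeaklyCompactOperator_zeroAtInfty (I := ULift.{u} ℕ)
    (f := fun i => f i.down)
    (fun i => hC' i.down) hf'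
  have hTx := hX C₀(ULift.{u} ℕ, ℝ) T hTc x hx
  rw [Metric.tendstoUniformlyOn_iff]
  intro ε hε
  obtain ⟨K, hK⟩ := Metric.tendsto_atTop.1 hTx ε hε
  -- For `k ≥ K` the norm of `T (x k)` controls all `f n (x k)` at once; the finitely many other `k`
  -- use that `f` is weakly null.
  have hfin : ∀ᶠ n in atTop, ∀ k ∈ Finset.range K, |f n (x k)| < ε := by
    rw [eventually_all_finset]
    intro k _
    have h := isWeaklyNull_iff.1 hf (NormedSpace.inclusionInDoubleDual ℝ X (x k))
    simpa [Real.dist_eq] using h.eventually (Metric.ball_mem_nhds 0 hε)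
  filter_upwards [hfin] with n hn
  rintro _ ⟨k, rfl⟩
  rw [Pi.zero_apply, dist_zero_left, Real.norm_eq_abs]
  rcases lt_or_ge k K with hk | hk
  · exact hn k (Finset.mem_range.2 hk)
  · have h1 := hK k hk
    rw [dist_zero_right] at h1
    have h2 := abs_zeroAtInfty_apply_le (T (x k)) (ULift.up n)
    rw [hT] at h2
    exact h2.trans_lt h1

/-- The passage to the convex hull costs nothing, since the functionals that are small at a given `x
n` form a convex set. -/
theorem IsLDunfordPettisSet.tendsto_apply {X : Type u} [NormedAddCommGroup X]
    [NormedSpace ℝ X] (hX : HasDunfordPettisProperty X) {A : Set (StrongDual ℝ X)}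
    (hA : IsLDunfordPettisSet A) {x : ℕ → X} (hx : IsWeaklyNull x) {f : ℕ → StrongDual ℝ X}
    (hf : ∀ n, f n ∈ convexHull ℝ A) : Tendsto (fun n => f n (x n)) atTop (𝓝 0) := by
  have h := Metric.tendstoUniformlyOn_iff.1 (hA.2 x hx (hX.isDunfordPettisSet_range hx))
  refine Metric.tendsto_nhds.2 fun ε hε => ?_
  filter_upwards [h ε hε] with n hn
  have hconv : Convex ℝ {g : StrongDual ℝ X | g (x n) ∈ Metric.ball 0 ε} :=
    (convex_ball (0 : ℝ) ε).is_linear_preimage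
      (NormedSpace.inclusionInDoubleDual ℝ X (x n)).toLinearMap.isLinear
  refine convexHull_min (fun g hg => ?_) hconv (hf n)
  simpa [Real.dist_eq] using hn g hg

end DunfordPettis

/-! ### Lattice inequalities and Riesz decomposition. -/

section VectorLattice

variable {E : Type*} [AddCommGroup E] [Lattice E] [IsOrderedAddMonoid E]

theorem add_inf_le_inf_add_inf {x y u : E} (hx : 0 ≤ x) (hy : 0 ≤ y) (hu : 0 ≤ u) :
    (x + y) ⊓ u ≤ x ⊓ u + y ⊓ u := by
  rw [inf_add, add_inf, add_inf]
  refine le_inf (le_inf inf_le_left ?_) (le_inf ?_ ?_)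
  · exact inf_le_right.trans (le_add_of_nonneg_left hx)
  · exact inf_le_right.trans (le_add_of_nonneg_right hy)
  · exact inf_le_right.trans (le_add_of_nonneg_left hu)

theorem inf_add_inf_le_add_inf_add (x y u v : E) : x ⊓ u + y ⊓ v ≤ (x + y) ⊓ (u + v) :=
  le_inf (add_le_add inf_le_left inf_le_left) (add_le_add inf_le_right inf_le_right)

theorem sub_inf_le_of_le_add {x y z : E} (hy : 0 ≤ y) (hz : z ≤ x + y) : z - z ⊓ x ≤ y := by
  rw [sub_le_iff_le_add', inf_add]
  exact le_inf (le_add_of_nonneg_right hy) hz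

open scoped Pointwise in
theorem Icc_zero_add_Icc_zero {x y : E} (hx : 0 ≤ x) (hy : 0 ≤ y) :
    Set.Icc 0 x + Set.Icc 0 y = Set.Icc 0 (x + y) := by
  ext z
  rw [Set.mem_add]
  constructor
  · rintro ⟨a, ⟨ha0, ha⟩, b, ⟨hb0, hb⟩, rfl⟩
    exact ⟨add_nonneg ha0 hb0, add_le_add ha hb⟩
  · rintro ⟨hz0, hz⟩
    exact ⟨z ⊓ x, ⟨le_inf hz0 hx, inf_le_right⟩, z - z ⊓ x,
      ⟨sub_nonneg.2 inf_le_left, sub_inf_le_of_le_add hy hz⟩, add_sub_cancel _ _⟩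

theorem inf_add_eq_zero {x a b : E} (hx : 0 ≤ x) (ha : 0 ≤ a) (hb : 0 ≤ b) (hxa : x ⊓ a = 0)
    (hxb : x ⊓ b = 0) : x ⊓ (a + b) = 0 := by
  refine le_antisymm ?_ (le_inf hx (add_nonneg ha hb))
  rw [inf_comm]
  refine (add_inf_le_inf_add_inf ha hb hx).trans ?_
  rw [inf_comm a, inf_comm b, hxa, hxb, add_zero]

theorem inf_nsmul_eq_zero {x a : E} (hx : 0 ≤ x) (ha : 0 ≤ a) (hxa : x ⊓ a = 0) (k : ℕ) :
    x ⊓ k • a = 0 := by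
  induction k with
  | zero => rw [zero_nsmul, inf_of_le_right hx]
  | succ k ih => rw [succ_nsmul]; exact inf_add_eq_zero hx (nsmul_nonneg ha k) ha ih hxa

theorem inf_sum_eq_zero {ι : Type*} {x : E} {a : ι → E} (hx : 0 ≤ x) (ha : ∀ i, 0 ≤ a i)
    {s : Finset ι} (h : ∀ i ∈ s, x ⊓ a i = 0) : x ⊓ ∑ i ∈ s, a i = 0 := by
  classical
  induction s using Finset.induction_on with
  | empty => rw [Finset.sum_empty, inf_of_le_right hx]
  | insert i s hi ih =>
    rw [Finset.sum_insert hi]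
    exact inf_add_eq_zero hx (ha i) (Finset.sum_nonneg fun j _ => ha j)
      (h i (Finset.mem_insert_self i s)) (ih fun j hj => h j (Finset.mem_insert_of_mem hj))

/-- Riesz decomposition. -/
theorem exists_sum_eq_of_le_sum {ι : Type*} {p : E} {w : ι → E} (hw : ∀ i, 0 ≤ w i)
    (s : Finset ι) (hp : 0 ≤ p) (h : p ≤ ∑ i ∈ s, w i) :
    ∃ q : ι → E, (∀ i ∈ s, 0 ≤ q i ∧ q i ≤ w i) ∧ ∑ i ∈ s, q i = p := by
  classical
  induction s using Finset.induction_on generalizing p with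
  | empty =>
    rw [Finset.sum_empty] at h
    exact ⟨fun _ => 0, by simp, by simpa using le_antisymm hp h⟩
  | insert i s hi ih =>
    rw [Finset.sum_insert hi] at h
    obtain ⟨q, hq, hqs⟩ := ih (p := p - p ⊓ w i) (sub_nonneg.2 inf_le_left)
      (sub_inf_le_of_le_add (Finset.sum_nonneg fun j _ => hw j) h)
    refine ⟨Function.update q i (p ⊓ w i), fun j hj => ?_, ?_⟩
    · rcases eq_or_ne j i with rfl | hji
      · rw [Function.update_self]; exact ⟨le_inf hp (hw j), inf_le_right⟩
      · rw [Function.update_of_ne hji]; exact hq j (Finset.mem_of_mem_insert_of_ne hj hji)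
    · rw [Finset.sum_insert hi, Function.update_self,
        Finset.sum_update_of_notMem hi, hqs, add_sub_cancel]

end VectorLattice

/-! ### Functionals built on the positive cone, and disjoint sequences. -/

section PositiveFunctionals

variable {E : Type*} [NormedAddCommGroup E] [Lattice E] [IsOrderedAddMonoid E]

theorem apply_le_apply_of_le [NormedSpace ℝ E] {h : StrongDual ℝ E} (hh : ∀ x, 0 ≤ x → 0 ≤ h x) {x y : E}
    (hxy : x ≤ y) : h x ≤ h y := by
  have := hh (y - x) (sub_nonneg.2 hxy)
  rw [map_sub] at this
  linarith

theorem tendsto_apply_of_tendsto_on_cone [NormedSpace ℝ E]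
    {f : ℕ → StrongDual ℝ E} {g : StrongDual ℝ E}
    (h : ∀ x, 0 ≤ x → Tendsto (fun n => f n x) atTop (𝓝 (g x))) (x : E) :
    Tendsto (fun n => f n x) atTop (𝓝 (g x)) := by
  have h1 := (h _ (posPart_nonneg x)).sub (h _ (negPart_nonneg x))
  simpa only [← map_sub, posPart_sub_negPart] using h1

variable [HasSolidNorm E]

theorem norm_le_norm_of_nonneg_of_le {x y : E} (hx : 0 ≤ x) (h : x ≤ y) : ‖x‖ ≤ ‖y‖ :=
  norm_le_norm_of_abs_le_abs (by rwa [abs_of_nonneg hx, abs_of_nonneg (hx.trans h)])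

theorem norm_posPart_le (x : E) : ‖x⁺‖ ≤ ‖x‖ := by
  rw [← norm_abs_eq_norm x]
  exact norm_le_norm_of_nonneg_of_le (posPart_nonneg x)
    (by rw [← posPart_add_negPart]; exact le_add_of_nonneg_right (negPart_nonneg x))

theorem norm_negPart_le (x : E) : ‖x⁻‖ ≤ ‖x‖ := by
  rw [← posPart_neg, ← norm_neg x]; exact norm_posPart_le _

variable [NormedSpace ℝ E]

/-- An additive bounded function on the positive cone extends to a bounded functional. -/
theorem exists_strongDual_eq_on_cone {P : E → ℝ} {C : ℝ}
    (hadd : ∀ x y, 0 ≤ x → 0 ≤ y → P (x + y) = P x + P y) (hP : ∀ x, 0 ≤ x → |P x| ≤ C * ‖x‖) :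
    ∃ f : StrongDual ℝ E, ∀ x, 0 ≤ x → f x = P x := by
  have hP0 : P 0 = 0 := by simpa using hadd 0 0 le_rfl le_rfl
  let F : E →+ ℝ := AddMonoidHom.mk' (fun x => P x⁺ - P x⁻) fun x y => by
    have h1 : (x + y)⁺ + (x⁻ + y⁻) = (x + y)⁻ + (x⁺ + y⁺) := by
      have h2 := posPart_sub_negPart (x + y)
      have h3 := posPart_sub_negPart x
      have h4 := posPart_sub_negPart y
      rw [← sub_eq_zero]
      calc _ = ((x + y)⁺ - (x + y)⁻) - (x⁺ - x⁻) - (y⁺ - y⁻) := by abel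
        _ = 0 := by rw [h2, h3, h4]; abel
    have h5 := congrArg P h1
    have hn := fun z : E => negPart_nonneg z
    have hp := fun z : E => posPart_nonneg z
    rw [hadd _ _ (hp _) (add_nonneg (hn _) (hn _)), hadd _ _ (hn _) (hn _),
      hadd _ _ (hn _) (add_nonneg (hp _) (hp _)), hadd _ _ (hp _) (hp _)] at h5
    linarith
  have hC : ∀ x, ‖F x‖ ≤ (2 * max C 0) * ‖x‖ := by
    intro x
    have h1 := hP _ (posPart_nonneg x)
    have h2 := hP _ (negPart_nonneg x)
    have h3 : C * ‖x⁺‖ ≤ max C 0 * ‖x‖ :=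
      mul_le_mul (le_max_left _ _) (norm_posPart_le x) (norm_nonneg _) (le_max_right _ _)
    have h4 : C * ‖x⁻‖ ≤ max C 0 * ‖x‖ :=
      mul_le_mul (le_max_left _ _) (norm_negPart_le x) (norm_nonneg _) (le_max_right _ _)
    calc ‖F x‖ = |P x⁺ - P x⁻| := rfl
      _ ≤ |P x⁺| + |P x⁻| := abs_sub _ _
      _ ≤ _ := by linarith
  -- Homogeneity is automatic: a continuous additive map of real spaces is linear.
  refine ⟨F.toRealLinearMap (AddMonoidHomClass.continuous_of_bound F _ hC), fun x hx => ?_⟩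
  change P x⁺ - P x⁻ = P x
  rw [posPart_of_nonneg hx, negPart_of_nonneg hx, hP0, sub_zero]

open scoped Pointwise in
/-- The positive part of a bounded functional, by the Riesz-Kantorovich formula. -/
theorem exists_posPart_functional (φ : StrongDual ℝ E) : ∃ h : StrongDual ℝ E,
    ∀ x, 0 ≤ x → IsLUB (φ '' Set.Icc 0 x) (h x) := by
  have hb : ∀ x, 0 ≤ x → ∀ y ∈ Set.Icc 0 x, φ y ≤ ‖φ‖ * ‖x‖ := fun x _ y hy =>
    (le_abs_self _).trans ((φ.le_opNorm y).trans
      (mul_le_mul_of_nonneg_left (norm_le_norm_of_nonneg_of_le hy.1 hy.2) (norm_nonneg _)))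
  have hbdd : ∀ x, 0 ≤ x → BddAbove (φ '' Set.Icc 0 x) := fun x hx =>
    ⟨‖φ‖ * ‖x‖, Set.forall_mem_image.2 (hb x hx)⟩
  have hne : ∀ x : E, 0 ≤ x → (φ '' Set.Icc 0 x).Nonempty := fun x hx =>
    ⟨φ 0, 0, ⟨le_rfl, hx⟩, rfl⟩
  obtain ⟨h, hh⟩ := exists_strongDual_eq_on_cone (P := fun x => sSup (φ '' Set.Icc 0 x)) (C := ‖φ‖)
    (fun x y hx hy => by
      rw [← Icc_zero_add_Icc_zero hx hy, Set.image_add,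
        csSup_add (hne x hx) (hbdd x hx) (hne y hy) (hbdd y hy)])
    (fun x hx => by
      have h0 : (0 : ℝ) ≤ sSup (φ '' Set.Icc 0 x) :=
        le_csSup (hbdd x hx) ⟨0, ⟨le_rfl, hx⟩, map_zero φ⟩
      rw [abs_of_nonneg h0]
      exact csSup_le (hne x hx) (Set.forall_mem_image.2 (hb x hx)))
  exact ⟨h, fun x hx => by rw [hh x hx]; exact isLUB_csSup (hne x hx) (hbdd x hx)⟩

/-- A positive functional dominating `φ` whose values are comparable to those of `φ` on order
intervals; one may think of `|φ|`. -/
theorem exists_abs_functional (φ : StrongDual ℝ E) : ∃ h : StrongDual ℝ E,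
    (∀ x, 0 ≤ x → 0 ≤ h x) ∧ (∀ x, 0 ≤ x → |φ x| ≤ h x) ∧
      ∀ x, 0 ≤ x → ∀ ε : ℝ, 0 < ε → ∃ y, 0 ≤ y ∧ y ≤ x ∧ h x < 2 * |φ y| + ε := by
  obtain ⟨h₁, hh₁⟩ := exists_posPart_functional φ
  obtain ⟨h₂, hh₂⟩ := exists_posPart_functional (-φ)
  have p₁ : ∀ x, 0 ≤ x → 0 ≤ h₁ x := fun x hx => (hh₁ x hx).1 ⟨0, ⟨le_rfl, hx⟩, map_zero _⟩
  have p₂ : ∀ x, 0 ≤ x → 0 ≤ h₂ x := fun x hx => (hh₂ x hx).1 ⟨0, ⟨le_rfl, hx⟩, map_zero _⟩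
  refine ⟨h₁ + h₂, fun x hx => add_nonneg (p₁ x hx) (p₂ x hx), fun x hx => ?_, fun x hx ε hε => ?_⟩
  · have a₁ : φ x ≤ h₁ x := (hh₁ x hx).1 ⟨x, ⟨hx, le_rfl⟩, rfl⟩
    have a₂ : -φ x ≤ h₂ x := (hh₂ x hx).1 ⟨x, ⟨hx, le_rfl⟩, rfl⟩
    have b₁ := p₁ x hx
    have b₂ := p₂ x hx
    rw [add_apply, abs_le]
    constructor <;> linarith
  · obtain ⟨_, ⟨y₁, hy₁, rfl⟩, l₁, -⟩ := (hh₁ x hx).exists_between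
      (show h₁ x - ε / 2 < h₁ x by linarith)
    obtain ⟨_, ⟨y₂, hy₂, rfl⟩, l₂, -⟩ := (hh₂ x hx).exists_between
      (show h₂ x - ε / 2 < h₂ x by linarith)
    rw [neg_apply] at l₂
    have c₁ := le_abs_self (φ y₁)
    have c₂ := neg_le_abs (φ y₂)
    -- The factor 2 pays for keeping only the better of the near-maximizers for `φ` and `-φ`.
    rcases le_total |φ y₁| |φ y₂| with hle | hle
    · exact ⟨y₂, hy₂.1, hy₂.2, by rw [add_apply]; linarith⟩
    · exact ⟨y₁, hy₁.1, hy₁.2, by rw [add_apply]; linarith⟩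

/-- A sequence of functionals that increases on the positive cone and is bounded by `h` there
converges pointwise. -/
theorem exists_tendsto_of_monotone_on_cone {Q : ℕ → E → ℝ} {h : StrongDual ℝ E}
    (h0 : ∀ n x, 0 ≤ x → 0 ≤ Q n x) (hmono : ∀ x, 0 ≤ x → Monotone fun n => Q n x)
    (hle : ∀ n x, 0 ≤ x → Q n x ≤ h x)
    (hadd : ∀ x y, 0 ≤ x → 0 ≤ y → ∀ n, ∃ m, Q n (x + y) ≤ Q m x + Q m y)
    (hadd' : ∀ x y, 0 ≤ x → 0 ≤ y → ∀ n, ∃ m, Q n x + Q n y ≤ Q m (x + y)) :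
    ∃ g : StrongDual ℝ E, ∀ x, 0 ≤ x → Tendsto (fun n => Q n x) atTop (𝓝 (g x)) := by
  have hbdd : ∀ x, 0 ≤ x → BddAbove (Set.range fun n => Q n x) := fun x hx =>
    ⟨h x, Set.forall_mem_range.2 fun n => hle n x hx⟩
  have hlim : ∀ x, 0 ≤ x → Tendsto (fun n => Q n x) atTop (𝓝 (⨆ n, Q n x)) := fun x hx =>
    tendsto_atTop_ciSup (hmono x hx) (hbdd x hx)
  obtain ⟨g, hg⟩ := exists_strongDual_eq_on_cone (P := fun x => ⨆ n, Q n x) (C := ‖h‖)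
    (fun x y hx hy => by
      have hxy := add_nonneg hx hy
      refine le_antisymm (ciSup_le fun n => ?_)
        (le_of_tendsto' ((hlim x hx).add (hlim y hy)) fun n => ?_)
      · obtain ⟨m, hm⟩ := hadd x y hx hy n
        exact hm.trans (add_le_add (le_ciSup (hbdd x hx) m) (le_ciSup (hbdd y hy) m))
      · obtain ⟨m, hm⟩ := hadd' x y hx hy n
        exact hm.trans (le_ciSup (hbdd _ hxy) m))
    (fun x hx => by
      rw [abs_of_nonneg ((h0 0 x hx).trans (le_ciSup (hbdd x hx) 0))]
      exact (ciSup_le fun n => hle n x hx).trans ((le_abs_self _).trans (h.le_opNorm x)))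
  exact ⟨g, fun x hx => by rw [hg x hx]; exact hlim x hx⟩

/-- The restriction of a positive functional to the band generated by `u`. -/
theorem exists_band_functional {h : StrongDual ℝ E} (hh : ∀ x, 0 ≤ x → 0 ≤ h x) {u : E}
    (hu : 0 ≤ u) : ∃ g : StrongDual ℝ E,
      ∀ x, 0 ≤ x → Tendsto (fun k : ℕ => h (x ⊓ k • u)) atTop (𝓝 (g x)) := by
  have hk : ∀ k : ℕ, 0 ≤ k • u := fun k => nsmul_nonneg hu k
  refine exists_tendsto_of_monotone_on_cone (h := h) (fun k x hx => hh _ (le_inf hx (hk k)))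
    (fun x _ i j hij => apply_le_apply_of_le hh
      (inf_le_inf_left _ (nsmul_le_nsmul_left hu hij)))
    (fun k x _ => apply_le_apply_of_le hh inf_le_left) (fun x y hx hy k => ⟨k, ?_⟩)
    (fun x y hx hy k => ⟨k + k, ?_⟩)
  · rw [← map_add]
    exact apply_le_apply_of_le hh (add_inf_le_inf_add_inf hx hy (hk k))
  · rw [← map_add, add_nsmul]
    exact apply_le_apply_of_le hh (inf_add_inf_le_add_inf_add _ _ _ _)

/-- In a Banach lattice with the Grothendieck property, bounded disjoint sequences are weakly
null. -/
theorem HasGrothendieckProperty.isWeaklyNull_of_disjoint (hE : HasGrothendieckProperty E)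
    {w : ℕ → E} (hw : ∀ n, 0 ≤ w n) (hdisj : ∀ i j, i ≠ j → w i ⊓ w j = 0) {C : ℝ}
    (hC : ∀ n, ‖w n‖ ≤ C) : IsWeaklyNull w := by
  rw [isWeaklyNull_iff]
  intro φ
  obtain ⟨h, hh, hφ, -⟩ := exists_abs_functional φ
  refine squeeze_zero_norm (fun n => hφ _ (hw n)) ?_
  by_contra hcon
  obtain ⟨δ, hδ, hfreq⟩ : ∃ δ > 0, ∃ᶠ n in atTop, δ ≤ h (w n) := by
    by_contra! hno
    refine hcon (Metric.tendsto_nhds.2 fun ε hε => ?_)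
    filter_upwards [hno ε hε] with n hn
    rw [dist_zero_right, Real.norm_of_nonneg (hh _ (hw n))]
    exact hn
  obtain ⟨σ, hσ, hσδ⟩ := extraction_of_frequently_atTop hfreq
  set v : ℕ → E := fun j => w (σ j) with hv
  have hv0 : ∀ j, 0 ≤ v j := fun j => hw _
  have hvd : ∀ i j, i ≠ j → v i ⊓ v j = 0 := fun i j hij => hdisj _ _ (hσ.injective.ne hij)
  set S : ℕ → E := fun N => ∑ i ∈ Finset.range N, v i with hS
  have hS0 : ∀ N, 0 ≤ S N := fun N => Finset.sum_nonneg fun i _ => hv0 i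
  have hSmono : Monotone S := fun M N hMN =>
    Finset.sum_le_sum_of_subset_of_nonneg (Finset.range_mono hMN) fun i _ _ => hv0 i
  -- `g N` is `h` restricted to the band of `v 0, …, v (N - 1)`: it vanishes at the later `v j` and
  -- is at least `δ` at these. The `g N` increase to a functional `G`.
  choose g hg using fun N => exists_band_functional hh (hS0 N)
  have hgvan : ∀ N j, N ≤ j → g N (v j) = 0 := by
    intro N j hNj
    refine tendsto_nhds_unique (hg N _ (hv0 j)) (tendsto_const_nhds.congr fun k => ?_)
    rw [inf_nsmul_eq_zero (hv0 j) (hS0 N) (inf_sum_eq_zero (hv0 j) hv0 fun i hi =>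
      hvd j i (by have := Finset.mem_range.1 hi; omega)), map_zero]
  have hgge : ∀ N j, j < N → δ ≤ g N (v j) := by
    intro N j hjN
    refine ge_of_tendsto (hg N _ (hv0 j)) ?_
    filter_upwards [eventually_ge_atTop 1] with k hk
    refine (hσδ j).trans (apply_le_apply_of_le hh (le_inf le_rfl ?_))
    calc v j ≤ S N := Finset.single_le_sum (fun i _ => hv0 i) (Finset.mem_range.2 hjN)
      _ = 1 • S N := (one_nsmul _).symm
      _ ≤ k • S N := nsmul_le_nsmul_left (hS0 N) hk
  have hg0 : ∀ N x, 0 ≤ x → 0 ≤ g N x := fun N x hx => ge_of_tendsto' (hg N x hx) fun k =>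
    hh _ (le_inf hx (nsmul_nonneg (hS0 N) k))
  have hgle : ∀ N x, 0 ≤ x → g N x ≤ h x := fun N x hx => le_of_tendsto' (hg N x hx) fun k =>
    apply_le_apply_of_le hh inf_le_left
  have hgmono : ∀ x, 0 ≤ x → Monotone fun N => g N x := fun x hx M N hMN =>
    le_of_tendsto_of_tendsto' (hg M x hx) (hg N x hx) fun k =>
      apply_le_apply_of_le hh (inf_le_inf_left _ (nsmul_le_nsmul_right (hSmono hMN) k))
  obtain ⟨G, hG⟩ := exists_tendsto_of_monotone_on_cone (Q := fun N x => g N x) hg0 hgmono hgle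
    (fun x y _ _ n => ⟨n, (map_add (g n) x y).le⟩) (fun x y _ _ n => ⟨n, (map_add (g n) x y).ge⟩)
  have hweak : Tendsto (fun N => toWeakSpace ℝ (StrongDual ℝ E) (g N)) atTop
      (𝓝 (toWeakSpace ℝ (StrongDual ℝ E) G)) :=
    (hE g G).1 (tendsto_iff_forall_eval_tendsto_topDualPairing.2
      (tendsto_apply_of_tendsto_on_cone hG))
  -- By Mazur, the weak limit `G` is a norm limit of convex combinations of the `g N`. Each
  -- combination vanishes at `v j` for large `j`, whereas `G (v j) ≥ δ` for all `j`.
  have hcl : toWeakSpace ℝ (StrongDual ℝ E) G ∈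
      toWeakSpace ℝ (StrongDual ℝ E) '' closure (convexHull ℝ (Set.range g)) := by
    rw [(convex_convexHull ℝ _).toWeakSpace_closure ℝ]
    exact mem_closure_of_tendsto hweak (Eventually.of_forall fun N =>
      ⟨g N, subset_convexHull ℝ _ ⟨N, rfl⟩, rfl⟩)
  obtain ⟨G', hG', hGG'⟩ := hcl
  obtain rfl := (toWeakSpace ℝ (StrongDual ℝ E)).injective hGG'
  have hC0 : 0 ≤ C := (norm_nonneg _).trans (hC 0)
  obtain ⟨c, hc, hdist⟩ := Metric.mem_closure_iff.1 hG' (δ / (C + 1)) (by positivity)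
  have hconv : Convex ℝ {f : StrongDual ℝ E | ∀ᶠ j in atTop, f (v j) = 0} := by
    intro f₁ h₁ f₂ h₂ a b _ _ _
    filter_upwards [h₁, h₂] with j hj₁ hj₂
    simp [hj₁, hj₂]
  have hcvan : ∀ᶠ j in atTop, c (v j) = 0 := by
    refine convexHull_min ?_ hconv hc
    rintro _ ⟨N, rfl⟩
    filter_upwards [eventually_ge_atTop N] with j hj using hgvan N j hj
  obtain ⟨j, hj⟩ := hcvan.exists
  have h1 : δ ≤ G' (v j) := (hgge (j + 1) j j.lt_succ_self).trans
    (Monotone.ge_of_tendsto (hgmono _ (hv0 j)) (hG _ (hv0 j)) (j + 1))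
  have h2 : |(G' - c) (v j)| ≤ ‖G' - c‖ * ‖v j‖ := (G' - c).le_opNorm _
  rw [sub_apply, hj, sub_zero] at h2
  rw [dist_eq_norm] at hdist
  have h3 : ‖G' - c‖ * ‖v j‖ ≤ δ / (C + 1) * C :=
    mul_le_mul hdist.le (hC _) (norm_nonneg _) (by positivity)
  have h4 : δ / (C + 1) * C < δ := by
    rw [div_mul_eq_mul_div, div_lt_iff₀ (by positivity)]
    nlinarith
  have h5 := le_abs_self (G' (v j))
  linarith

end PositiveFunctionals

/-! ### Positive parts, for the disjointification. -/

section PosPart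

variable {E : Type*} [AddCommGroup E] [Lattice E] [IsOrderedAddMonoid E]

theorem posPart_inf_posPart_neg_nsmul (z : E) (r : ℕ) : z⁺ ⊓ (-(r • z))⁺ = 0 := by
  refine le_antisymm ?_ (le_inf (posPart_nonneg _) (posPart_nonneg _))
  have h1 : (-(r • z))⁺ ≤ r • z⁻ := by
    rw [← smul_neg]
    exact sup_le (nsmul_le_nsmul_right (neg_le_negPart z) r) (nsmul_nonneg (negPart_nonneg z) r)
  refine (inf_le_inf_left _ h1).trans (le_of_eq ?_)
  exact inf_nsmul_eq_zero (posPart_nonneg z) (negPart_nonneg z) (posPart_inf_negPart_eq_zero z) r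

theorem posPart_le_posPart_sub_add {a b : E} (hb : 0 ≤ b) : a⁺ ≤ (a - b)⁺ + b :=
  sup_le (by simpa using add_le_add_left (le_posPart (a - b)) b)
    (add_nonneg (posPart_nonneg _) hb)

end PosPart

/-! ### Concentration on one order interval. -/

section EquiIntegrability

variable {E : Type*} [NormedAddCommGroup E] [NormedSpace ℝ E] [Lattice E] [IsOrderedAddMonoid E]

theorem apply_partialSups_le_sum {h : StrongDual ℝ E} (hh : ∀ x, 0 ≤ x → 0 ≤ h x) {x : ℕ → E}
    (hx : ∀ n, 0 ≤ x n) (k : ℕ) : h (partialSups x k) ≤ ∑ j ∈ Finset.range (k + 1), h (x j) := by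
  induction k with
  | zero => simp
  | succ k ih =>
    rw [Finset.sum_range_succ, ← Order.succ_eq_add_one, partialSups_succ]
    refine le_trans ?_ (add_le_add_left ih _)
    rw [← map_add]
    have h0 : 0 ≤ partialSups x k := (hx 0).trans (le_partialSups_of_le x (Nat.zero_le k))
    exact apply_le_apply_of_le hh
      (sup_le (le_add_of_nonneg_right (hx _)) (le_add_of_nonneg_left h0))

variable [HasSolidNorm E]

/-- A functional that may be thought of as `|φ|`. -/
noncomputable def absFunctional (φ : StrongDual ℝ E) : StrongDual ℝ E :=
  (exists_abs_functional φ).choose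

theorem absFunctional_nonneg (φ : StrongDual ℝ E) : ∀ x, 0 ≤ x → 0 ≤ absFunctional φ x :=
  (exists_abs_functional φ).choose_spec.1

theorem abs_apply_le_absFunctional (φ : StrongDual ℝ E) {x : E} (hx : 0 ≤ x) :
    |φ x| ≤ absFunctional φ x :=
  (exists_abs_functional φ).choose_spec.2.1 x hx

theorem exists_absFunctional_lt (φ : StrongDual ℝ E) {x : E} (hx : 0 ≤ x) {ε : ℝ} (hε : 0 < ε) :
    ∃ y, 0 ≤ y ∧ y ≤ x ∧ absFunctional φ x < 2 * |φ y| + ε :=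
  (exists_abs_functional φ).choose_spec.2.2 x hx ε hε

theorem absFunctional_mono (φ : StrongDual ℝ E) {x y : E} (h : x ≤ y) :
    absFunctional φ x ≤ absFunctional φ y :=
  apply_le_apply_of_le (absFunctional_nonneg φ) h

variable {A : Set (StrongDual ℝ E)} {C : ℝ}

/-- If weakly null sequences converge to zero uniformly on the bounded set `A` in the dual of a
Banach lattice with the Grothendieck property, then up to `ε` the members of `A` live on a single
order interval. -/
theorem exists_forall_abs_apply_posPart_sub_le [IsOrderedModule ℝ E] [CompleteSpace E]
    (hE : HasGrothendieckProperty E)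
    (hA : ∀ x : ℕ → E, IsWeaklyNull x → ∀ f : ℕ → StrongDual ℝ E, (∀ n, f n ∈ A) →
      Tendsto (fun n => f n (x n)) atTop (𝓝 0))
    (hC : ∀ f ∈ A, ‖f‖ ≤ C) {ε : ℝ} (hε : 0 < ε) :
    ∃ u : E, 0 ≤ u ∧ ∀ x, 0 ≤ x → ‖x‖ ≤ 1 → ∀ f ∈ A, |f (x - u)⁺| ≤ ε := by
  by_contra! H
  choose! ξ hξ0 hξ1 F hF hlt using H
  -- `S n = x 0 + ⋯ + x (n - 1)`, where `x n` and a member of `A` violate the claim for `u = 4 ^ n •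
  -- S n`.
  let S : ℕ → E := fun n => Nat.rec 0 (fun n s => s + ξ (4 ^ n • s)) n
  let x : ℕ → E := fun n => ξ (4 ^ n • S n)
  have hS_succ : ∀ n, S (n + 1) = S n + x n := fun n => rfl
  have hS0 : ∀ n, 0 ≤ S n := by
    intro n
    induction n with
    | zero => exact le_rfl
    | succ n ih => rw [hS_succ]; exact add_nonneg ih (hξ0 _ (nsmul_nonneg ih _))
  have hu : ∀ n, 0 ≤ 4 ^ n • S n := fun n => nsmul_nonneg (hS0 n) _
  have hx0 : ∀ n, 0 ≤ x n := fun n => hξ0 _ (hu n)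
  have hx1 : ∀ n, ‖x n‖ ≤ 1 := fun n => hξ1 _ (hu n)
  have hSmono : Monotone S := monotone_nat_of_le_succ fun n => by
    rw [hS_succ]; exact le_add_of_nonneg_right (hx0 n)
  have hxS : ∀ i j, i < j → x i ≤ S j := fun i j hij =>
    (show x i ≤ S (i + 1) by rw [hS_succ]; exact le_add_of_nonneg_left (hS0 i)).trans (hSmono hij)
  have hsum : Summable fun n => ((1 / 2 : ℝ) ^ n) • x n := by
    refine Summable.of_norm_bounded summable_geometric_two fun n => ?_
    rw [norm_smul, Real.norm_of_nonneg (by positivity)]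
    exact mul_le_of_le_one_right (by positivity) (hx1 n)
  set T : E := ∑' n, ((1 / 2 : ℝ) ^ n) • x n with hT
  have hterm0 : ∀ n, 0 ≤ ((1 / 2 : ℝ) ^ n) • x n := fun n => smul_nonneg (by positivity) (hx0 n)
  have hxT : ∀ n, ((1 / 2 : ℝ) ^ n) • x n ≤ T := fun n =>
    hsum.le_tsum n fun j _ => hterm0 j
  have hT0 : 0 ≤ T := (hterm0 0).trans (hxT 0)
  have hTn : ∀ n, 0 ≤ ((1 / 2 : ℝ) ^ n) • T := fun n => smul_nonneg (by positivity) hT0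
  -- Subtracting `2⁻ⁿ T` makes the sequence disjoint: for `i < j`, `w i ≤ (x i - 4⁻ʲ x j)⁺` and `w j
  -- ≤ (x j - 4ʲ x i)⁺`. The correction tends to zero in norm, so the values of the functionals stay
  -- away from zero.
  let w : ℕ → E := fun n => (x n - 4 ^ n • S n - ((1 / 2 : ℝ) ^ n) • T)⁺
  have hw0 : ∀ n, 0 ≤ w n := fun n => posPart_nonneg _
  have hwle : ∀ n, w n ≤ x n := fun n =>
    sup_le ((sub_le_self _ (hTn n)).trans (sub_le_self _ (hu n))) (hx0 n)
  have hlt_disj : ∀ i j, i < j → w i ⊓ w j = 0 := by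
    intro i j hij
    refine le_antisymm ?_ (le_inf (hw0 i) (hw0 j))
    have h1 : w i ≤ (x i - ((1 / 4 : ℝ) ^ j) • x j)⁺ := by
      refine posPart_mono (sub_le_sub (sub_le_self _ (hu i)) ?_)
      refine le_trans ?_ (smul_le_smul_of_nonneg_left (hxT j) (by positivity))
      rw [smul_smul]
      refine smul_le_smul_of_nonneg_right ?_ (hx0 j)
      calc (1 / 4 : ℝ) ^ j = (1 / 2 : ℝ) ^ j * (1 / 2 : ℝ) ^ j := by rw [← mul_pow]; norm_num
        _ ≤ (1 / 2 : ℝ) ^ i * (1 / 2 : ℝ) ^ j := by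
          gcongr ?_ * _
          exact pow_le_pow_of_le_one (by norm_num) (by norm_num) hij.le
    have h2 : w j ≤ (-(4 ^ j • (x i - ((1 / 4 : ℝ) ^ j) • x j)))⁺ := by
      refine posPart_mono ((sub_le_self _ (hTn j)).trans ?_)
      have h3 : (4 ^ j : ℕ) • ((1 / 4 : ℝ) ^ j) • x j = x j := by
        rw [← Nat.cast_smul_eq_nsmul ℝ, smul_smul]
        push_cast
        rw [← mul_pow]
        norm_num
      rw [nsmul_sub, h3, neg_sub]
      exact sub_le_sub_left (nsmul_le_nsmul_right (hxS i j hij) _) _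
    exact (inf_le_inf h1 h2).trans (posPart_inf_posPart_neg_nsmul _ _).le
  have hdisj : ∀ i j, i ≠ j → w i ⊓ w j = 0 := by
    intro i j hij
    rcases hij.lt_or_gt with h | h
    · exact hlt_disj i j h
    · rw [inf_comm]; exact hlt_disj j i h
  have hwnull := hE.isWeaklyNull_of_disjoint hw0 hdisj
    (fun n => (norm_le_norm_of_nonneg_of_le (hw0 n) (hwle n)).trans (hx1 n))
  let f : ℕ → StrongDual ℝ E := fun n => F (4 ^ n • S n)
  have hf : ∀ n, f n ∈ A := fun n => hF _ (hu n)
  have hlim := (hA w hwnull f hf).abs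
  have hgeom : Tendsto (fun n : ℕ => C * ((1 / 2 : ℝ) ^ n * ‖T‖)) atTop (𝓝 (C * (0 * ‖T‖))) :=
    ((tendsto_pow_atTop_nhds_zero_of_lt_one (by norm_num) (by norm_num)).mul_const _).const_mul _
  have hle : ∀ n, ε ≤ |f n (w n)| + C * ((1 / 2 : ℝ) ^ n * ‖T‖) := by
    intro n
    have h1 : ε < |f n (x n - 4 ^ n • S n)⁺| := hlt _ (hu n)
    have h2 : f n (x n - 4 ^ n • S n)⁺ = f n (w n) + f n ((x n - 4 ^ n • S n)⁺ - w n) := by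
      rw [← map_add, add_sub_cancel]
    have h3 : ‖(x n - 4 ^ n • S n)⁺ - w n‖ ≤ (1 / 2 : ℝ) ^ n * ‖T‖ := by
      have h4 : ‖((1 / 2 : ℝ) ^ n) • T‖ = (1 / 2 : ℝ) ^ n * ‖T‖ := by
        rw [norm_smul, Real.norm_of_nonneg (by positivity)]
      rw [← h4]
      exact norm_le_norm_of_nonneg_of_le
        (sub_nonneg.2 (posPart_mono (sub_le_self _ (hTn n))))
        (sub_le_iff_le_add'.2 (posPart_le_posPart_sub_add (hTn n)))
    have h5 : |f n ((x n - 4 ^ n • S n)⁺ - w n)| ≤ C * ((1 / 2 : ℝ) ^ n * ‖T‖) :=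
      ((f n).le_opNorm _).trans (mul_le_mul (hC _ (hf n)) h3 (norm_nonneg _)
        ((norm_nonneg _).trans (hC _ (hf n))))
    rw [h2] at h1
    linarith [abs_add_le (f n (w n)) (f n ((x n - 4 ^ n • S n)⁺ - w n))]
  have := ge_of_tendsto' (hlim.add hgeom) hle
  simp at this
  linarith

/-- Uniform Cauchy property of order bounded increasing sequences. -/
theorem exists_forall_absFunctional_sub_le
    (hA : ∀ x : ℕ → E, IsWeaklyNull x → ∀ f : ℕ → StrongDual ℝ E, (∀ n, f n ∈ A) →
      Tendsto (fun n => f n (x n)) atTop (𝓝 0))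
    {y : ℕ → E} (hy : Monotone y) {b : E} (hb : ∀ n, y n ≤ b) {ε : ℝ} (hε : 0 < ε) :
    ∃ N, ∀ m, N ≤ m → ∀ f ∈ A, absFunctional f (y m - y N) ≤ ε := by
  by_contra! H
  choose m hm f hf hlt using H
  have hnonneg : ∀ N, 0 ≤ y (m N) - y N := fun N => sub_nonneg.2 (hy (hm N))
  choose e he0 hele helt using fun N => exists_absFunctional_lt (f N) (hnonneg N) (half_pos hε)
  -- Iterating `m` puts the `e (k n)` below consecutive increments of `y`. Their sums telescope
  -- under `absFunctional φ`, so `e (k n)` is weakly null.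
  let k : ℕ → ℕ := fun n => Nat.rec 0 (fun _ j => m j) n
  have hk : ∀ n, k (n + 1) = m (k n) := fun n => rfl
  have hnull : IsWeaklyNull fun n => e (k n) := by
    rw [isWeaklyNull_iff]
    intro φ
    have hsum : Summable fun n => |φ (e (k n))| := by
      refine summable_of_sum_range_le (c := absFunctional φ (b - y 0)) (fun _ => abs_nonneg _)
        fun n => ?_
      calc ∑ i ∈ Finset.range n, |φ (e (k i))|
          ≤ ∑ i ∈ Finset.range n, (absFunctional φ (y (k (i + 1))) - absFunctional φ (y (k i))) := by
            refine Finset.sum_le_sum fun i _ => ?_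
            rw [← map_sub, hk]
            exact (abs_apply_le_absFunctional φ (he0 _)).trans (absFunctional_mono φ (hele _))
        _ = absFunctional φ (y (k n)) - absFunctional φ (y (k 0)) :=
            Finset.sum_range_sub (fun i => absFunctional φ (y (k i))) n
        _ ≤ absFunctional φ (b - y 0) := by
            rw [← map_sub]
            exact absFunctional_mono φ (sub_le_sub_right (hb _) _)
    exact (tendsto_zero_iff_abs_tendsto_zero _).2 hsum.tendsto_atTop_zero
  have hlim := (hA _ hnull (fun n => f (k n)) fun n => hf _).abs
  have hge : ∀ n, ε / 4 ≤ |f (k n) (e (k n))| := fun n => by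
    have h1 := hlt (k n)
    have h2 := helt (k n)
    linarith
  have := ge_of_tendsto' hlim hge
  simp at this
  linarith

end EquiIntegrability

/-! ### Domination on an order interval by one functional. -/

section EquiIntegrability

variable {E : Type*} [NormedAddCommGroup E] [NormedSpace ℝ E] [Lattice E] [IsOrderedAddMonoid E]
  [HasSolidNorm E] {A : Set (StrongDual ℝ E)} {C : ℝ}

/-- Under the uniform Cauchy property on increasing sequences, a sequence of elements `x n` of an
order interval that is asymptotically negligible for each of the functionals `f i` cannot satisfy
`δ < |f n| (x n)` for all `n`. -/
theorem false_of_lt_absFunctional_of_le_geometric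
    (hA : ∀ x : ℕ → E, IsWeaklyNull x → ∀ f : ℕ → StrongDual ℝ E, (∀ n, f n ∈ A) →
      Tendsto (fun n => f n (x n)) atTop (𝓝 0))
    {u : E} {x : ℕ → E} (hx0 : ∀ n, 0 ≤ x n) (hxu : ∀ n, x n ≤ u) {f : ℕ → StrongDual ℝ E}
    (hf : ∀ n, f n ∈ A) {δ D : ℝ} (hδ : 0 < δ) (hD : 0 ≤ D)
    (hlt : ∀ n, δ < absFunctional (f n) (x n))
    (hgeo : ∀ i n, i < n → absFunctional (f i) (x n) ≤ D * (1 / 2 : ℝ) ^ n) : False := by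
  let Y : ℕ → ℕ → E := fun n k => partialSups (fun j => x (n + j)) k
  have hYu : ∀ n k, Y n k ≤ u := fun n k => partialSups_le _ _ _ fun j _ => hxu _
  have hYmono : ∀ n, Monotone (Y n) := fun n => partialSups_monotone _
  have hxY : ∀ n k, x n ≤ Y n k := fun n k =>
    le_partialSups_of_le (fun j => x (n + j)) (Nat.zero_le k)
  have hYgeo : ∀ i n k, i < n → absFunctional (f i) (Y n k) ≤ 2 * D * (1 / 2 : ℝ) ^ n := by
    intro i n k hin
    calc absFunctional (f i) (Y n k)
        ≤ ∑ j ∈ Finset.range (k + 1), absFunctional (f i) (x (n + j)) :=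
          apply_partialSups_le_sum (absFunctional_nonneg _) (fun j => hx0 _) k
      _ ≤ ∑ j ∈ Finset.range (k + 1), D * (1 / 2 : ℝ) ^ n * (1 / 2 : ℝ) ^ j :=
          Finset.sum_le_sum fun j _ => by
            rw [mul_assoc, ← pow_add]; exact hgeo i (n + j) (by omega)
      _ ≤ D * (1 / 2 : ℝ) ^ n * 2 := by
          rw [← Finset.mul_sum]
          exact mul_le_mul_of_nonneg_left (sum_geometric_two_le _) (by positivity)
      _ = _ := by ring
  choose K hK using fun n => exists_forall_absFunctional_sub_le hA (hYmono n) (hYu n)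
    (show (0 : ℝ) < δ / 8 * (1 / 2) ^ n by positivity)
  -- `z n` replaces the possibly missing supremum of the tail `x n, x (n + 1), …`, with an error
  -- that is small uniformly on `A`. The infima `z' n` restore monotonicity at a total cost of `δ /
  -- 4`.
  let z : ℕ → E := fun n => Y n (K n)
  let z' : ℕ → E := fun n => Nat.rec (z 0) (fun n y => y ⊓ z (n + 1)) n
  have hz'succ : ∀ n, z' (n + 1) = z' n ⊓ z (n + 1) := fun n => rfl
  have hxz : ∀ n, x n ≤ z n := fun n => hxY n _
  have hz'z : ∀ n, z' n ≤ z n := fun n => by cases n; exacts [le_rfl, inf_le_right]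
  have hz'0 : ∀ n, 0 ≤ z' n := fun n => by
    induction n with
    | zero => exact (hx0 0).trans (hxz 0)
    | succ n ih => exact le_inf ih ((hx0 _).trans (hxz _))
  have hz'anti : Antitone z' := antitone_nat_of_succ_le fun n => inf_le_left
  have hsub : ∀ (y : E) n, y - z' n ≤ ∑ i ∈ Finset.range (n + 1), (y - z i)⁺ := by
    intro y n
    induction n with
    | zero =>
      rw [zero_add, Finset.sum_range_one]
      exact le_posPart (y - z 0)
    | succ n ih =>
      rw [Finset.sum_range_succ, hz'succ, sub_le_iff_le_add', inf_add]
      have h0 : 0 ≤ ∑ i ∈ Finset.range (n + 1), (y - z i)⁺ :=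
        Finset.sum_nonneg fun i _ => posPart_nonneg _
      refine le_inf ?_ ?_
      · rw [← sub_le_iff_le_add']
        exact ih.trans (le_add_of_nonneg_right (posPart_nonneg _))
      · rw [← sub_le_iff_le_add']
        exact (le_posPart _).trans (le_add_of_nonneg_left h0)
  have hzz : ∀ i n, i ≤ n → ∀ g ∈ A,
      absFunctional g (z n - z i)⁺ ≤ δ / 8 * (1 / 2 : ℝ) ^ i := by
    intro i n hin g hg
    have hM := hK i (max (K i) (n - i + K n)) (le_max_left _ _) g hg
    refine (absFunctional_mono g (sup_le (sub_le_sub_right ?_ _)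
      (sub_nonneg.2 (hYmono i (le_max_left _ _))))).trans hM
    refine partialSups_le _ _ _ fun j hj => ?_
    have h1 := le_partialSups_of_le (fun j => x (i + j))
      (show n - i + j ≤ max (K i) (n - i + K n) by omega)
    have h2 : i + (n - i + j) = n + j := by omega
    simp only [h2] at h1
    exact h1
  have hclose : ∀ n, ∀ g ∈ A, absFunctional g (z n - z' n) ≤ δ / 4 := by
    intro n g hg
    calc absFunctional g (z n - z' n)
        ≤ absFunctional g (∑ i ∈ Finset.range (n + 1), (z n - z i)⁺) :=
          absFunctional_mono g (hsub _ _)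
      _ = ∑ i ∈ Finset.range (n + 1), absFunctional g (z n - z i)⁺ := map_sum _ _ _
      _ ≤ ∑ i ∈ Finset.range (n + 1), δ / 8 * (1 / 2 : ℝ) ^ i :=
          Finset.sum_le_sum fun i hi =>
            hzz i n (Nat.lt_succ_iff.1 (Finset.mem_range.1 hi)) g hg
      _ ≤ δ / 8 * 2 := by
          rw [← Finset.mul_sum]
          exact mul_le_mul_of_nonneg_left (sum_geometric_two_le _) (by positivity)
      _ = δ / 4 := by ring
  obtain ⟨N, hN⟩ := exists_forall_absFunctional_sub_le hA (y := fun n => -z' n)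
    (fun i j hij => neg_le_neg (hz'anti hij)) (b := 0) (fun n => neg_nonpos.2 (hz'0 n))
    (show (0 : ℝ) < δ / 4 by positivity)
  -- Write `h` for `absFunctional (f N)`. From `h (x N) > δ`, two losses of `δ / 4` (from `z N` to
  -- `z' N`, then to `z' m`) leave `h (z m) ≥ h (z' m) ≥ δ / 2`, but `h (z m)` decays geometrically
  -- in `m`.
  have hbig : δ / 2 ≤ 2 * D * 0 := by
    refine ge_of_tendsto ((tendsto_pow_atTop_nhds_zero_of_lt_one (r := (1 / 2 : ℝ))
      (by norm_num) (by norm_num)).const_mul (2 * D)) ?_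
    filter_upwards [eventually_gt_atTop N] with m hm
    have h1 := hN m hm.le (f N) (hf N)
    have h2 := hclose N (f N) (hf N)
    have h3 := hlt N
    have h4 := absFunctional_mono (f N) (hxz N)
    have h5 := absFunctional_mono (f N) (hz'z m)
    have h6 : absFunctional (f N) (z m) ≤ _ := hYgeo N m (K m) hm
    simp only [map_sub, map_neg] at h1 h2
    linarith
  linarith

/-- If weakly null sequences converge to zero uniformly on the bounded set `A` of functionals, then
on each order interval the members of `A` are dominated, up to `δ`, by a single functional. -/
theorem exists_dominating_functional
    (hA : ∀ x : ℕ → E, IsWeaklyNull x → ∀ f : ℕ → StrongDual ℝ E, (∀ n, f n ∈ A) →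
      Tendsto (fun n => f n (x n)) atTop (𝓝 0))
    (hC : ∀ f ∈ A, ‖f‖ ≤ C) (u : E) {δ : ℝ} (hδ : 0 < δ) :
    ∃ g : StrongDual ℝ E, (∀ x, 0 ≤ x → 0 ≤ g x) ∧
      ∀ f ∈ A, ∀ x, 0 ≤ x → x ≤ u → |f x| ≤ g x + δ := by
  by_contra! H
  choose! F hF ξ hξ0 hξu hlt using H
  -- `G n` is the sum of the moduli of `f 0, …, f (n - 1)`, and `f n`, `x n` violate domination by
  -- `2 ^ n • G n`. Since `|f n (x n)| ≤ C * ‖u‖`, the earlier moduli are at most `C * ‖u‖ / 2 ^ n`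
  -- at `x n`.
  let G : ℕ → StrongDual ℝ E := fun n =>
    Nat.rec 0 (fun n g => g + absFunctional (F ((2 : ℝ) ^ n • g))) n
  let f : ℕ → StrongDual ℝ E := fun n => F ((2 : ℝ) ^ n • G n)
  let x : ℕ → E := fun n => ξ ((2 : ℝ) ^ n • G n)
  have hG_succ : ∀ n, G (n + 1) = G n + absFunctional (f n) := fun n => rfl
  have hG0 : ∀ n x, 0 ≤ x → 0 ≤ G n x := by
    intro n y hy
    induction n with
    | zero => exact le_rfl
    | succ n ih =>
      rw [hG_succ]
      exact add_nonneg ih (absFunctional_nonneg _ y hy)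
  have hfG : ∀ i n, i < n → ∀ y, 0 ≤ y → absFunctional (f i) y ≤ G n y := by
    intro i n hin y hy
    induction n, hin using Nat.le_induction with
    | base => rw [hG_succ]; exact le_add_of_nonneg_left (hG0 i y hy)
    | succ n _ ih => rw [hG_succ]; exact ih.trans (le_add_of_nonneg_right
        (absFunctional_nonneg _ y hy))
  have hpos : ∀ n y, 0 ≤ y → 0 ≤ ((2 : ℝ) ^ n • G n) y := fun n y hy =>
    mul_nonneg (by positivity) (hG0 n y hy)
  have hf : ∀ n, f n ∈ A := fun n => hF _ (hpos n)
  have hx0 : ∀ n, 0 ≤ x n := fun n => hξ0 _ (hpos n)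
  have hxu : ∀ n, x n ≤ u := fun n => hξu _ (hpos n)
  have hlt' : ∀ n, (2 : ℝ) ^ n * G n (x n) + δ < |f n (x n)| := fun n => hlt _ (hpos n)
  have hC0 : 0 ≤ C := (norm_nonneg _).trans (hC _ (hf 0))
  refine false_of_lt_absFunctional_of_le_geometric hA hx0 hxu hf hδ
    (show 0 ≤ C * ‖u‖ by positivity) (fun n => ?_) fun i n hin => ?_
  · have h1 := hlt' n
    have h2 := mul_nonneg (show (0 : ℝ) ≤ 2 ^ n by positivity) (hG0 n _ (hx0 n))
    have h3 := abs_apply_le_absFunctional (f n) (hx0 n)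
    linarith
  · have h1 := hlt' n
    have h2 : |f n (x n)| ≤ C * ‖u‖ := ((f n).le_opNorm _).trans
      (mul_le_mul (hC _ (hf n)) (norm_le_norm_of_nonneg_of_le (hx0 n) (hxu n)) (norm_nonneg _) hC0)
    have h3 := mul_le_mul_of_nonneg_left (hfG i n hin _ (hx0 n))
      (show (0 : ℝ) ≤ 2 ^ n by positivity)
    rw [one_div, inv_pow, ← div_eq_mul_inv, le_div_iff₀ (by positivity), mul_comm]
    linarith

end EquiIntegrability

/-! ### Quantitative convexity of the Euclidean norm of the plane. -/

section UniformConvexity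

/-- All three roots are at most `3 * b`. Rationalizing twice gives `(a - c)² ≤ 108 b D` for the
midpoint defect `D`, and `|a - c| ≤ κ b + (a - c)² / (4 κ b)` turns 108 into 27. -/
theorem abs_sub_le_of_lt_two_mul {a c b κ : ℝ} (hκ : 0 < κ) (ha : |a| < 2 * b)
    (hc : |c| < 2 * b) :
    |a - c| ≤ κ * b + 27 / κ * (√(a ^ 2 + b ^ 2) + √(c ^ 2 + b ^ 2)
      - 2 * √(((a + c) / 2) ^ 2 + b ^ 2)) := by
  have hb : 0 < b := by linarith [abs_nonneg a]
  obtain ⟨ha1, ha2⟩ := abs_lt.1 ha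
  obtain ⟨hc1, hc2⟩ := abs_lt.1 hc
  have hsq : ∀ t, -(2 * b) ≤ t → t ≤ 2 * b → √(t ^ 2 + b ^ 2) ≤ 3 * b := fun t h1 h2 => by
    refine Real.sqrt_le_iff.2 ⟨by linarith, ?_⟩
    nlinarith [mul_nonneg (sub_nonneg.2 h1) (sub_nonneg.2 h2)]
  have hp := hsq a ha1.le ha2.le
  have hr := hsq c hc1.le hc2.le
  have hm := hsq ((a + c) / 2) (by linarith) (by linarith)
  have hp2 : √(a ^ 2 + b ^ 2) ^ 2 = a ^ 2 + b ^ 2 := Real.sq_sqrt (by positivity)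
  have hr2 : √(c ^ 2 + b ^ 2) ^ 2 = c ^ 2 + b ^ 2 := Real.sq_sqrt (by positivity)
  have hm2 : √(((a + c) / 2) ^ 2 + b ^ 2) ^ 2 = ((a + c) / 2) ^ 2 + b ^ 2 :=
    Real.sq_sqrt (by positivity)
  have hp0 : 0 < √(a ^ 2 + b ^ 2) := Real.sqrt_pos.2 (by positivity)
  have hr0 : 0 < √(c ^ 2 + b ^ 2) := Real.sqrt_pos.2 (by positivity)
  have hm0 : 0 < √(((a + c) / 2) ^ 2 + b ^ 2) := Real.sqrt_pos.2 (by positivity)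
  generalize √(a ^ 2 + b ^ 2) = p at *
  generalize √(c ^ 2 + b ^ 2) = r at *
  generalize √(((a + c) / 2) ^ 2 + b ^ 2) = m at *
  set q := a * c + b ^ 2 with hq
  have h1 : (p * r - q) * (p * r + q) = b ^ 2 * (a - c) ^ 2 := by
    have : (p * r) ^ 2 = (a ^ 2 + b ^ 2) * (c ^ 2 + b ^ 2) := by rw [mul_pow, hp2, hr2]
    calc _ = (p * r) ^ 2 - q ^ 2 := by ring
      _ = _ := by rw [this, hq]; ring
  have hqle : |q| ≤ p * r := by
    refine abs_le_of_sq_le_sq ?_ (by positivity)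
    nlinarith [mul_nonneg (sq_nonneg b) (sq_nonneg (a - c))]
  obtain ⟨hq1, hq2⟩ := abs_le.1 hqle
  have hpr : p * r ≤ 9 * b ^ 2 := by nlinarith
  have h2 : (a - c) ^ 2 ≤ 18 * (p * r - q) := by
    have h3 : (p * r - q) * (p * r + q) ≤ (p * r - q) * (18 * b ^ 2) :=
      mul_le_mul_of_nonneg_left (by linarith) (by linarith)
    have h4 : b ^ 2 * (a - c) ^ 2 ≤ b ^ 2 * (18 * (p * r - q)) := by nlinarith
    exact le_of_mul_le_mul_left h4 (by positivity)
  have h5 : (p + r - 2 * m) * (p + r + 2 * m) = 2 * (p * r - q) := by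
    calc _ = p ^ 2 + r ^ 2 + 2 * (p * r) - 4 * m ^ 2 := by ring
      _ = _ := by rw [hp2, hr2, hm2, hq]; ring
  have hD0 : 0 ≤ p + r - 2 * m := by
    by_contra hneg
    have := mul_neg_of_neg_of_pos (not_le.1 hneg) (show 0 < p + r + 2 * m by positivity)
    linarith
  have h6 : (a - c) ^ 2 ≤ 108 * b * (p + r - 2 * m) := by
    have h7 : (p + r - 2 * m) * (p + r + 2 * m) ≤ (p + r - 2 * m) * (12 * b) :=
      mul_le_mul_of_nonneg_left (by linarith) hD0
    nlinarith
  have h8 : κ * |a - c| * (4 * b) ≤ κ * (κ * b + 27 / κ * (p + r - 2 * m)) * (4 * b) := by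
    have h9 : κ * (κ * b + 27 / κ * (p + r - 2 * m)) * (4 * b)
        = 4 * (κ * b) ^ 2 + 108 * b * (p + r - 2 * m) := by
      field_simp
      ring
    rw [h9]
    nlinarith [sq_nonneg (|a - c| - 2 * (κ * b)), sq_abs (a - c)]
  exact le_of_mul_le_mul_left (le_of_mul_le_mul_right h8 (by linarith)) hκ

/-- Minkowski's inequality in the plane; through it, refining a partition increases the sums `∑ √(f²
+ g²)`. -/
theorem sqrt_add_sq_le (a a' b b' : ℝ) :
    √((a + a') ^ 2 + (b + b') ^ 2) ≤ √(a ^ 2 + b ^ 2) + √(a' ^ 2 + b' ^ 2) := by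
  have h1 : a * a' + b * b' ≤ √(a ^ 2 + b ^ 2) * √(a' ^ 2 + b' ^ 2) := by
    rw [← Real.sqrt_mul (by positivity)]
    refine Real.le_sqrt_of_sq_le ?_
    nlinarith [sq_nonneg (a * b' - b * a')]
  refine Real.sqrt_le_iff.2 ⟨by positivity, ?_⟩
  nlinarith [Real.sq_sqrt (show 0 ≤ a ^ 2 + b ^ 2 by positivity),
    Real.sq_sqrt (show 0 ≤ a' ^ 2 + b' ^ 2 by positivity)]

/-- Quantitative strict convexity of the Euclidean norm of the plane along the first coordinate,
away from the first axis. -/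
theorem abs_sub_le_add_sqrt {a c b κ : ℝ} (hb : 0 ≤ b) (hκ : 0 < κ) :
    |a - c| ≤ κ * b + 27 / κ * (√(a ^ 2 + b ^ 2) + √(c ^ 2 + b ^ 2)
      - 2 * √(((a + c) / 2) ^ 2 + b ^ 2)) + 4 * max (|a| - b) 0 + 4 * max (|c| - b) 0 := by
  have hmid : 2 * √(((a + c) / 2) ^ 2 + b ^ 2) ≤ √(a ^ 2 + b ^ 2) + √(c ^ 2 + b ^ 2) := by
    have h := sqrt_add_sq_le a c b b
    have h2 : (a + c) ^ 2 + (b + b) ^ 2 = 2 ^ 2 * (((a + c) / 2) ^ 2 + b ^ 2) := by ring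
    rwa [h2, Real.sqrt_mul (by positivity), Real.sqrt_sq (by norm_num)] at h
  have hD : 0 ≤ 27 / κ * (√(a ^ 2 + b ^ 2) + √(c ^ 2 + b ^ 2)
      - 2 * √(((a + c) / 2) ^ 2 + b ^ 2)) := mul_nonneg (by positivity) (by linarith)
  have hκb := mul_nonneg hκ.le hb
  have ha := le_max_left (|a| - b) 0
  have hc := le_max_left (|c| - b) 0
  have ha' := le_max_right (|a| - b) 0
  have hc' := le_max_right (|c| - b) 0
  have hac := abs_sub a c
  by_cases h : |a| < 2 * b ∧ |c| < 2 * b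
  · linarith [abs_sub_le_of_lt_two_mul hκ h.1 h.2]
  -- If the larger modulus `M` is at least `2 * b`, then `|a - c| ≤ 2 * M ≤ 4 * (M - b)`.
  · rcases le_total |a| |c| with hle | hle
    · have : 2 * b ≤ |c| := by
        by_contra hlt
        exact h ⟨hle.trans_lt (not_le.1 hlt), not_le.1 hlt⟩
      linarith
    · have : 2 * b ≤ |a| := by
        by_contra hlt
        exact h ⟨not_le.1 hlt, hle.trans_lt (not_le.1 hlt)⟩
      linarith

end UniformConvexity

/-! ### The modulus `√(f² + g²)` on an order interval. -/

section PartitionFunctional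

variable {E : Type*} [NormedAddCommGroup E] [NormedSpace ℝ E] [Lattice E]

/-- The values `∑ √(f (w i)² + g (w i)²)` over the finite partitions `w` of `u`. -/
def partitionSums (g : StrongDual ℝ E) (u : E) (f : StrongDual ℝ E) : Set ℝ :=
  {r | ∃ (ι : Type) (_ : Fintype ι) (w : ι → E), (∀ i, 0 ≤ w i) ∧ ∑ i, w i = u ∧
    r = ∑ i, √(f (w i) ^ 2 + g (w i) ^ 2)}

/-- The modulus `√(f² + g²)` evaluated at `u`. -/
noncomputable def partitionModulus (g : StrongDual ℝ E) (u : E) (f : StrongDual ℝ E) : ℝ :=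
  sSup (partitionSums g u f)

variable {g : StrongDual ℝ E} {u : E} {δ : ℝ}

theorem partitionSums_nonempty (hu : 0 ≤ u) (f : StrongDual ℝ E) :
    (partitionSums g u f).Nonempty :=
  ⟨_, Unit, inferInstance, fun _ => u, fun _ => hu, by simp, rfl⟩

variable [IsOrderedAddMonoid E]

/-- The sum is the value of `f - g` at a single point of `[0, u]`, the sum of those pieces where `f
- g` is nonnegative. The bound therefore does not depend on the number of pieces. -/
theorem sum_max_apply_sub_le {f : StrongDual ℝ E}
    (hf : ∀ x, 0 ≤ x → x ≤ u → f x ≤ g x + δ) {ι : Type*} [Fintype ι] {w : ι → E}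
    (hw : ∀ i, 0 ≤ w i) (hsum : ∑ i, w i = u) : ∑ i, max (f (w i) - g (w i)) 0 ≤ δ := by
  classical
  have h1 : ∑ i, max (f (w i) - g (w i)) 0
      = ∑ i with 0 ≤ f (w i) - g (w i), (f (w i) - g (w i)) := by
    rw [Finset.sum_filter]
    refine Finset.sum_congr rfl fun i _ => ?_
    split_ifs with h
    · exact max_eq_left h
    · exact max_eq_right (not_le.1 h).le
  rw [h1, Finset.sum_sub_distrib, ← map_sum, ← map_sum]
  have h2 := hf (∑ i with 0 ≤ f (w i) - g (w i), w i) (Finset.sum_nonneg fun i _ => hw i) (by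
    rw [← hsum]
    exact Finset.sum_le_sum_of_subset_of_nonneg (Finset.filter_subset _ _) fun i _ _ => hw i)
  linarith

theorem sum_max_abs_apply_sub_le {f : StrongDual ℝ E}
    (hf : ∀ x, 0 ≤ x → x ≤ u → |f x| ≤ g x + δ) {ι : Type*} [Fintype ι] {w : ι → E}
    (hw : ∀ i, 0 ≤ w i) (hsum : ∑ i, w i = u) : ∑ i, max (|f (w i)| - g (w i)) 0 ≤ 2 * δ := by
  have h1 := sum_max_apply_sub_le (f := f) (fun x h0 hx => (le_abs_self _).trans (hf x h0 hx))
    hw hsum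
  have h2 := sum_max_apply_sub_le (f := -f) (fun x h0 hx => (neg_le_abs (f x)).trans (hf x h0 hx))
    hw hsum
  calc ∑ i, max (|f (w i)| - g (w i)) 0
      ≤ ∑ i, (max (f (w i) - g (w i)) 0 + max ((-f) (w i) - g (w i)) 0) := by
        refine Finset.sum_le_sum fun i _ => ?_
        rw [neg_apply]
        have a1 := le_max_left (f (w i) - g (w i)) 0
        have a2 := le_max_right (f (w i) - g (w i)) 0
        have a3 := le_max_left (-f (w i) - g (w i)) 0
        have a4 := le_max_right (-f (w i) - g (w i)) 0
        refine max_le ?_ (by linarith)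
        rcases abs_cases (f (w i)) with ⟨h, -⟩ | ⟨h, -⟩ <;> rw [h] <;> linarith
    _ ≤ 2 * δ := by rw [Finset.sum_add_distrib]; linarith

theorem le_of_mem_partitionSums (hg : ∀ x, 0 ≤ x → 0 ≤ g x) {f : StrongDual ℝ E}
    (hf : ∀ x, 0 ≤ x → x ≤ u → |f x| ≤ g x + δ) :
    ∀ r ∈ partitionSums g u f, r ≤ 2 * g u + 2 * δ := by
  rintro _ ⟨ι, _, w, hw, hsum, rfl⟩
  have h1 := sum_max_abs_apply_sub_le hf hw hsum
  calc ∑ i, √(f (w i) ^ 2 + g (w i) ^ 2)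
      ≤ ∑ i, (2 * g (w i) + max (|f (w i)| - g (w i)) 0) := by
        refine Finset.sum_le_sum fun i _ => ?_
        have h2 := hg _ (hw i)
        have h3 : √(f (w i) ^ 2 + g (w i) ^ 2) ≤ |f (w i)| + g (w i) := by
          refine Real.sqrt_le_iff.2 ⟨by positivity, ?_⟩
          nlinarith [sq_abs (f (w i)), mul_nonneg (abs_nonneg (f (w i))) h2]
        linarith [le_max_left (|f (w i)| - g (w i)) 0]
    _ ≤ 2 * g u + 2 * δ := by
        rw [Finset.sum_add_distrib, ← Finset.mul_sum, ← map_sum, hsum]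
        linarith

theorem abs_partitionModulus_le (hu : 0 ≤ u) (hg : ∀ x, 0 ≤ x → 0 ≤ g x) {f : StrongDual ℝ E}
    (hf : ∀ x, 0 ≤ x → x ≤ u → |f x| ≤ g x + δ) :
    |partitionModulus g u f| ≤ 2 * g u + 2 * δ := by
  rw [abs_of_nonneg]
  · exact csSup_le (partitionSums_nonempty hu f) (le_of_mem_partitionSums hg hf)
  · refine Real.sSup_nonneg ?_
    rintro _ ⟨ι, _, w, -, -, rfl⟩
    exact Finset.sum_nonneg fun i _ => Real.sqrt_nonneg _

/-- If the modulus is almost affine at the midpoint of `c` and `d`, then `c` and `d` are close on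
the order interval `[0, u]`. -/
theorem abs_sub_apply_le_of_partitionModulus (hu : 0 ≤ u) (hg : ∀ x, 0 ≤ x → 0 ≤ g x)
    {c d : StrongDual ℝ E}
    (hc : ∀ x, 0 ≤ x → x ≤ u → |c x| ≤ g x + δ) (hd : ∀ x, 0 ≤ x → x ≤ u → |d x| ≤ g x + δ)
    {η κ : ℝ} (hη : 0 < η) (hκ : 0 < κ)
    (hcd : partitionModulus g u c + partitionModulus g u d
      - 2 * partitionModulus g u ((1 / 2 : ℝ) • (c + d)) ≤ η) {p : E} (hp0 : 0 ≤ p)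
    (hpu : p ≤ u) : |(c - d) p| ≤ κ * g u + 27 / κ * (2 * η) + 16 * δ := by
  obtain ⟨_, ⟨ι, _, w, hw, hsum, rfl⟩, hlt⟩ := exists_lt_of_lt_csSup
    (partitionSums_nonempty (g := g) hu ((1 / 2 : ℝ) • (c + d)))
    (show partitionModulus g u ((1 / 2 : ℝ) • (c + d)) - η / 2 < _ from
      sub_lt_self _ (half_pos hη))
  -- Riesz decomposition refines a nearly optimal partition for the midpoint so that `p` becomes a
  -- sum of pieces. Refinement only increases the midpoint sum, so the defect on `w'` is at most `η
  -- + 2 * (η / 2)`.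
  obtain ⟨q, hq, hqp⟩ := exists_sum_eq_of_le_sum hw Finset.univ hp0 (hpu.trans hsum.ge)
  let w' : ι ⊕ ι → E := Sum.elim q (fun i => w i - q i)
  have hw' : ∀ i, 0 ≤ w' i := by
    rintro (i | i)
    · exact (hq i (Finset.mem_univ i)).1
    · exact sub_nonneg.2 (hq i (Finset.mem_univ i)).2
  have hsum' : ∑ i, w' i = u := by
    rw [Fintype.sum_sum_type, ← hsum, ← Finset.sum_add_distrib]
    exact Finset.sum_congr rfl fun i _ => add_sub_cancel _ _
  have hle : ∀ f : StrongDual ℝ E, (∀ x, 0 ≤ x → x ≤ u → |f x| ≤ g x + δ) →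
      ∑ i, √(f (w' i) ^ 2 + g (w' i) ^ 2) ≤ partitionModulus g u f := fun f hf =>
    le_csSup ⟨_, le_of_mem_partitionSums hg hf⟩ ⟨ι ⊕ ι, inferInstance, w', hw', hsum', rfl⟩
  have hmid : ∀ x, ((1 / 2 : ℝ) • (c + d)) x = (c x + d x) / 2 := fun x => by
    simp only [smul_apply, add_apply, smul_eq_mul]; ring
  have hrefine : ∑ i, √(((1 / 2 : ℝ) • (c + d)) (w i) ^ 2 + g (w i) ^ 2)
      ≤ ∑ i, √(((c (w' i) + d (w' i)) / 2) ^ 2 + g (w' i) ^ 2) := by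
    rw [Fintype.sum_sum_type, ← Finset.sum_add_distrib]
    refine Finset.sum_le_sum fun i _ => ?_
    refine le_trans (le_of_eq ?_) (sqrt_add_sq_le _ _ _ _)
    simp only [hmid, w', Sum.elim_inl, Sum.elim_inr, map_sub]
    ring_nf
  have hc1 := hle c hc
  have hd1 := hle d hd
  have hc2 := sum_max_abs_apply_sub_le hc hw' hsum'
  have hd2 := sum_max_abs_apply_sub_le hd hw' hsum'
  have hgsum : ∑ i, g (w' i) = g u := by rw [← map_sum, hsum']
  have hp : |(c - d) p| ≤ ∑ i, |c (w' i) - d (w' i)| := by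
    rw [Fintype.sum_sum_type, ← hqp, map_sum]
    refine (Finset.abs_sum_le_sum_abs _ _).trans
      (le_add_of_le_of_nonneg le_rfl (Finset.sum_nonneg fun i _ => abs_nonneg _))
  have hmain : ∑ i, |c (w' i) - d (w' i)| ≤ κ * ∑ i, g (w' i)
      + 27 / κ * (∑ i, √(c (w' i) ^ 2 + g (w' i) ^ 2) + ∑ i, √(d (w' i) ^ 2 + g (w' i) ^ 2)
        - 2 * ∑ i, √(((c (w' i) + d (w' i)) / 2) ^ 2 + g (w' i) ^ 2))
      + 4 * ∑ i, max (|c (w' i)| - g (w' i)) 0 + 4 * ∑ i, max (|d (w' i)| - g (w' i)) 0 := by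
    simp only [Finset.mul_sum, ← Finset.sum_add_distrib, ← Finset.sum_sub_distrib]
    exact Finset.sum_le_sum fun i _ => abs_sub_le_add_sqrt (hg _ (hw' i)) hκ
  have hD : 27 / κ * (∑ i, √(c (w' i) ^ 2 + g (w' i) ^ 2) + ∑ i, √(d (w' i) ^ 2 + g (w' i) ^ 2)
        - 2 * ∑ i, √(((c (w' i) + d (w' i)) / 2) ^ 2 + g (w' i) ^ 2)) ≤ 27 / κ * (2 * η) :=
    mul_le_mul_of_nonneg_left (by linarith) (by positivity)
  rw [hgsum] at hmain
  linarith

end PartitionFunctional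

/-! ### From the order interval to the norm, and the conclusion. -/

/-- Positive vectors split as `x = x ⊓ u + (x - u)⁺`; passing to `x⁺ - x⁻` doubles the bound. -/
theorem norm_sub_le_of_forall_Icc {E : Type*} [NormedAddCommGroup E] [NormedSpace ℝ E] [Lattice E]
    [IsOrderedAddMonoid E] [HasSolidNorm E] {c d : StrongDual ℝ E} {u : E} (hu : 0 ≤ u) {ε τ : ℝ}
    (hτ : ∀ p, 0 ≤ p → p ≤ u → |(c - d) p| ≤ τ)
    (hc : ∀ x, 0 ≤ x → ‖x‖ ≤ 1 → |c (x - u)⁺| ≤ ε)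
    (hd : ∀ x, 0 ≤ x → ‖x‖ ≤ 1 → |d (x - u)⁺| ≤ ε) : ‖c - d‖ ≤ 2 * τ + 4 * ε := by
  have hpos : ∀ x, 0 ≤ x → ‖x‖ ≤ 1 → |(c - d) x| ≤ τ + 2 * ε := by
    intro x hx hx1
    have h1 : (c - d) x = (c - d) (x ⊓ u) + (c (x - u)⁺ - d (x - u)⁺) := by
      rw [← sub_apply, ← map_add, inf_eq_sub_posPart_sub, sub_add_cancel]
    have h2 := hτ (x ⊓ u) (le_inf hx hu) inf_le_right
    have h3 := hc x hx hx1
    have h4 := hd x hx hx1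
    rw [h1]
    linarith [abs_add_le ((c - d) (x ⊓ u)) (c (x - u)⁺ - d (x - u)⁺),
      abs_sub (c (x - u)⁺) (d (x - u)⁺)]
  have h0 := (abs_nonneg _).trans (hpos 0 le_rfl (by simp))
  refine ContinuousLinearMap.opNorm_le_of_unit_norm (by linarith) fun x hx => ?_
  have h1 := hpos x⁺ (posPart_nonneg x) ((norm_posPart_le x).trans hx.le)
  have h2 := hpos x⁻ (negPart_nonneg x) ((norm_negPart_le x).trans hx.le)
  have h3 : (c - d) x = (c - d) x⁺ - (c - d) x⁻ := by rw [← map_sub, posPart_sub_negPart]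
  rw [h3, Real.norm_eq_abs]
  linarith [abs_sub ((c - d) x⁺) ((c - d) x⁻)]

theorem mainTheorem5 {E : Type u} [NormedAddCommGroup E] [NormedSpace ℝ E] [CompleteSpace E]
    [Lattice E] [IsOrderedAddMonoid E] [IsOrderedModule ℝ E] [HasSolidNorm E]
    (hDP : HasDunfordPettisProperty E) (hG : HasGrothendieckProperty E) :
    HasLDunfordPettisProperty E := by
  intro A hA
  refine IsRelativelyWeaklyCompact.mono ?_ (subset_convexHull ℝ A)
  have hB : Bornology.IsBounded (convexHull ℝ A) := isBounded_convexHull.2 hA.1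
  obtain ⟨C, hC⟩ := hB.exists_norm_le
  have hL : ∀ x : ℕ → E, IsWeaklyNull x → ∀ f : ℕ → StrongDual ℝ E,
      (∀ n, f n ∈ convexHull ℝ A) → Tendsto (fun n => f n (x n)) atTop (𝓝 0) :=
    fun x hx f hf => hA.tendsto_apply hDP hx hf
  refine isRelativelyWeaklyCompact_of_midpoint (convex_convexHull ℝ A) hB fun θ hθ => ?_
  obtain ⟨u, hu, hAu⟩ := exists_forall_abs_apply_posPart_sub_le hG hL hC
    (show 0 < θ / 16 by positivity)
  obtain ⟨g, hg, hAg⟩ := exists_dominating_functional hL hC u (show 0 < θ / 128 by positivity)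
  have hgu := hg u hu
  -- With `η = κ θ / 432` and `δ = θ / 128`, each of the three terms bounding `c - d` on `[0, u]` is
  -- at most `θ / 8`. The norm is then at most `2 * (3 θ / 8) + 4 * (θ / 16) = θ`. The `+ 1` covers
  -- `g u = 0`.
  set κ := θ / (8 * (g u + 1)) with hκ
  have hκ0 : 0 < κ := by positivity
  have hκg : κ * g u ≤ θ / 8 := by
    rw [hκ, div_mul_eq_mul_div, div_le_div_iff₀ (by positivity) (by positivity)]
    nlinarith
  refine ⟨partitionModulus g u, _, κ * θ / 432, by positivity,
    fun c hc => abs_partitionModulus_le hu hg (hAg c hc), fun c hc d hd hcd => ?_⟩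
  have hη : 27 / κ * (2 * (κ * θ / 432)) = θ / 8 := by field_simp; ring
  have h := norm_sub_le_of_forall_Icc hu (fun p hp0 hpu =>
    abs_sub_apply_le_of_partitionModulus hu hg (hAg c hc) (hAg d hd) (by positivity) hκ0 hcd hp0 hpu)
    (fun x hx hx1 => hAu x hx hx1 c hc) (fun x hx hx1 => hAu x hx hx1 d hd)
  linarith
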